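/- Let $k\ge 2$, let $A$ be an alphabet with $k$ letters, and let $A^*$ be the free monoid of words over $A$. A right ideal of $A^*$ is essential if it intersects every nonempty right ideal. Let $\mathsf{riAut}(k)$ be the monoid, under composition, of all injective partial functions $\varphi$ on $A^*$ with $\varphi(xw)=\varphi(x)w$ for all $x\in\mathsf{Dom}(\varphi)$, $w\in A^*$, whose domain and image are finitely generated essential right ideals. Every $\varphi\in\mathsf{riAut}(k)$ has a unique maximal extension $\max(\varphi)\in\mathsf{riAut}(k)$. The Thompson–Higman group is $G_{k,1}=\{\max(\varphi):\varphi\in\mathsf{riAut}(k)\}$ with product $\psi\cdot\varphi=\max(\psi\circ\varphi)$; put $\eta(\varphi)=\max(\varphi)$. Generating sets are generating sets as a monoid. For a generating set $\Gamma$ of a group $G$, the $\Gamma$-generated suffix expansion $(G^{\sim\mathcal L})_\Gamma$ is the submonoid generated by the pairs $(\gamma,\{\gamma,1\})$, $\gamma\in\Gamma$, of the monoid of all pairs $(g,S)$ with $S\subseteq G$ finite and $\{g,1\}\subseteq S$, under the multiplication $(y,T)(x,S)=(yx,\,Tx\cup S)$. A set $\Gamma\subseteq G_{k,1}$ satisfies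 the surjectiveness condition if there is a generating set $\Delta$ of $\mathsf{riAut}(k)$ such that for every $\delta\in\Delta$ there is $\gamma\in\Gamma$ with $\mathsf{Dom}(\delta)=\mathsf{Dom}(\gamma)$. Let $\rho(g,S)=(g,\bigcap_{h\in S}\mathsf{Dom}(h))$ for $(g,S)\in (G_{k,1}^{\sim\mathcal L})_\Gamma$, and $e(\varphi)=(\eta(\varphi),\mathsf{Dom}(\varphi))$ for $\varphi\in\mathsf{riAut}(k)$. **(1)** For every generating set $\Delta$ of $\mathsf{riAut}(k)$ there is a generating set $\Gamma$ of $G_{k,1}$ such that for every $\delta\in\Delta$ there is $\gamma\in\Gamma$ with $\mathsf{Dom}(\delta)=\mathsf{Dom}(\gamma)$ (so $\Gamma$ satisfies the surjectiveness condition); and if $\Delta$ is finite, then $\Gamma$ is finite and $|\Gamma|\le 2|\Delta|$. The generating set $\Gamma=G_{k,1}$ also satisfies the surjectiveness condition. **(2)** If $\Gamma$ is a generating set of $G_{k,1}$ such that $\rho$ maps $(G_{k,1}^{\sim\mathcal L})_\Gamma$ onto $e(\mathsf{riAut}(k))$, then $\Gamma$ satisfies the surjectiveness condition. **(3)** Some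 generating set of $G_{k,1}$ does not satisfy the surjectiveness condition. More strongly, for $k=2$ and $A=\{0,1\}$, let $\Gamma_{\rm CFP}=\{A_0,B_0,C_0,\pi_0\}$ be the Cannon–Floyd–Parry set, with the four elements given by the tables $A_0$: $0\mapsto 00,\ 10\mapsto 01,\ 11\mapsto 1$; $B_0$: $0\mapsto 0,\ 10\mapsto 100,\ 110\mapsto 101,\ 111\mapsto 11$; $C_0$: $0\mapsto 11,\ 10\mapsto 0,\ 11\mapsto 10$; $\pi_0$: $0\mapsto 10,\ 10\mapsto 0,\ 11\mapsto 11$. Then $\Gamma_{\rm CFP}$ is a four-element generating set of $G_{2,1}$, it does not satisfy the surjectiveness condition, and there is no surjective homomorphism from $(G_{2,1}^{\sim\mathcal L})_{\Gamma_{\rm CFP}}$ onto $\mathsf{riAut}(2)$. -/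

import Mathlib

/-! Words over the alphabet `Fin k` are `List (Fin k)`; `k` is arbitrary in the definitions. -/

/-- A right ideal of the free monoid of words: `R A* ⊆ R`. -/
def IsRightIdeal {k : ℕ} (R : Set (List (Fin k))) : Prop :=
  ∀ x ∈ R, ∀ w : List (Fin k), x ++ w ∈ R

/-- The right ideal `R` is generated by a finite set of words: `R = C A*` with `C` finite. -/
def IsFinGen {k : ℕ} (R : Set (List (Fin k))) : Prop :=
  ∃ C : Set (List (Fin k)), C.Finite ∧ R = {x | ∃ c ∈ C, ∃ w : List (Fin k), x = c ++ w}

/-- A right ideal that intersects every (nonempty) right ideal. -/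
def IsEssentialRightIdeal {k : ℕ} (R : Set (List (Fin k))) : Prop :=
  IsRightIdeal R ∧
    ∀ J : Set (List (Fin k)), IsRightIdeal J → J.Nonempty → (R ∩ J).Nonempty

/-- Working criterion: a right ideal is essential and finitely generated iff it meets every cone
and contains all sufficiently long words. -/
theorem essential_finGen_iff {k : ℕ} (R : Set (List (Fin k))) :
    (IsEssentialRightIdeal R ∧ IsFinGen R) ↔
      (IsRightIdeal R ∧ (∀ x : List (Fin k), ∃ w, x ++ w ∈ R) ∧
        ∃ N : ℕ, ∀ x : List (Fin k), N ≤ x.length → x ∈ R) := by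
  constructor
  · rintro ⟨⟨hR, hE⟩, C, hC, rfl⟩
    have hcone : ∀ x : List (Fin k), ∃ w,
        x ++ w ∈ {x : List (Fin k) | ∃ c ∈ C, ∃ w : List (Fin k), x = c ++ w} := by
      intro x
      obtain ⟨z, hz, w, rfl⟩ := hE {z | ∃ w, z = x ++ w}
        (by rintro _ ⟨w, rfl⟩ v; exact ⟨w ++ v, by simp⟩) ⟨x, [], by simp⟩
      exact ⟨w, hz⟩
    refine ⟨hR, hcone, ?_⟩
    obtain ⟨N, hN⟩ := (hC.image List.length).bddAbove
    refine ⟨N, fun x hx => ?_⟩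
    obtain ⟨w, c, hc, v, hv⟩ := hcone x
    have hcN : c.length ≤ N := hN ⟨c, hc, rfl⟩
    have h1 : c <+: x ++ w := ⟨v, hv.symm⟩
    have h2 : c <+: x := List.prefix_of_prefix_length_le h1 (List.prefix_append x w) (by omega)
    obtain ⟨u, hu⟩ := h2
    exact ⟨c, hc, u, hu.symm⟩
  · rintro ⟨hR, hcone, N, hN⟩
    refine ⟨⟨hR, ?_⟩, {x | x ∈ R ∧ x.length ≤ N}, ?_, ?_⟩
    · rintro J hJ ⟨x, hx⟩
      obtain ⟨w, hw⟩ := hcone x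
      exact ⟨x ++ w, hw, hJ x hx w⟩
    · exact (List.finite_length_le (Fin k) N).subset (fun x hx => hx.2)
    · ext x
      constructor
      · intro hx
        by_cases h : x.length ≤ N
        · exact ⟨x, ⟨hx, h⟩, [], by simp⟩
        · exact ⟨x.take N, ⟨hN _ (by simp; omega), by simp⟩, x.drop N, by simp⟩
      · rintro ⟨c, ⟨hc, -⟩, w, rfl⟩
        exact hR c hc w

/-- A right ideal automorphism of the free monoid with finite table: an injective partial function
on words (a `PEquiv`) commuting with right concatenation, whose domain and image are essential
finitely generated right ideals. These are the elements of the monoid `riAut(k)`. -/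
@[ext]
structure RiAut (k : ℕ) where
  toPEquiv : List (Fin k) ≃. List (Fin k)
  map_append : ∀ x y w : List (Fin k), y ∈ toPEquiv x → y ++ w ∈ toPEquiv (x ++ w)
  dom_essential : IsEssentialRightIdeal {x | ∃ y, y ∈ toPEquiv x}
  dom_finGen : IsFinGen {x | ∃ y, y ∈ toPEquiv x}
  im_essential : IsEssentialRightIdeal {y | ∃ x, y ∈ toPEquiv x}
  im_finGen : IsFinGen {y | ∃ x, y ∈ toPEquiv x}

namespace RiAut

variable {k : ℕ}

/-- The domain `Dom(φ)`. -/
def Dom (φ : RiAut k) : Set (List (Fin k)) := {x | ∃ y, y ∈ φ.toPEquiv x}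

/-- The image `Im(φ)`. -/
def Im (φ : RiAut k) : Set (List (Fin k)) := {y | ∃ x, y ∈ φ.toPEquiv x}

theorem dom_criterion (φ : RiAut k) :
    IsRightIdeal φ.Dom ∧ (∀ x : List (Fin k), ∃ w, x ++ w ∈ φ.Dom) ∧
        ∃ N : ℕ, ∀ x : List (Fin k), N ≤ x.length → x ∈ φ.Dom :=
  (essential_finGen_iff _).1 ⟨φ.dom_essential, φ.dom_finGen⟩

theorem im_criterion (φ : RiAut k) :
    IsRightIdeal φ.Im ∧ (∀ x : List (Fin k), ∃ w, x ++ w ∈ φ.Im) ∧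
        ∃ N : ℕ, ∀ x : List (Fin k), N ≤ x.length → x ∈ φ.Im :=
  (essential_finGen_iff _).1 ⟨φ.im_essential, φ.im_finGen⟩

theorem ext_mem {φ ψ : RiAut k} (h : ∀ x y, y ∈ φ.toPEquiv x ↔ y ∈ ψ.toPEquiv x) : φ = ψ := by
  apply RiAut.ext
  ext x y
  exact h x y

/-- Constructor from the working criterion. -/
def mk' (f : List (Fin k) ≃. List (Fin k))
    (hf : ∀ x y w : List (Fin k), y ∈ f x → y ++ w ∈ f (x ++ w))
    (d1 : ∀ x : List (Fin k), ∃ w, ∃ y, y ∈ f (x ++ w))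
    (d2 : ∃ N : ℕ, ∀ x : List (Fin k), N ≤ x.length → ∃ y, y ∈ f x)
    (i1 : ∀ y : List (Fin k), ∃ w, ∃ x, y ++ w ∈ f x)
    (i2 : ∃ N : ℕ, ∀ y : List (Fin k), N ≤ y.length → ∃ x, y ∈ f x) : RiAut k :=
  have hd := (essential_finGen_iff {x | ∃ y, y ∈ f x}).2
    ⟨by rintro x ⟨y, hy⟩ w; exact ⟨y ++ w, hf x y w hy⟩, d1, d2⟩
  have hi := (essential_finGen_iff {y | ∃ x, y ∈ f x}).2
    ⟨by rintro y ⟨x, hy⟩ w; exact ⟨x ++ w, hf x y w hy⟩, i1, i2⟩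
  ⟨f, hf, hd.1, hd.2, hi.1, hi.2⟩

instance : One (RiAut k) :=
  ⟨mk' (PEquiv.refl _) (by simp) (fun x => ⟨[], x, by simp⟩) ⟨0, by simp⟩
    (fun x => ⟨[], x, by simp⟩) ⟨0, by simp⟩⟩

theorem mem_one {x y : List (Fin k)} : y ∈ (1 : RiAut k).toPEquiv x ↔ x = y := by
  change y ∈ (PEquiv.refl _) x ↔ _
  simp

/-- Long words have long images (used to see that composites have finite tables). -/
theorem exists_length_bound (φ : RiAut k) (M : ℕ) : ∃ N : ℕ, ∀ x y : List (Fin k),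
    N ≤ x.length → y ∈ φ.toPEquiv x → M ≤ y.length := by
  obtain ⟨B, hB⟩ := (((List.finite_length_le (Fin k) M).image
    (fun y => ((φ.toPEquiv.symm y).getD []).length))).bddAbove
  refine ⟨B + 1, fun x y hx hy => ?_⟩
  by_contra hlt
  have h1 : φ.toPEquiv.symm y = some x := (PEquiv.mem_iff_mem φ.toPEquiv).2 hy
  have h2 : x.length ≤ B := hB ⟨y, by simp; omega, by simp [h1]⟩
  omega

/-- The inverse partial function. -/
def symm (φ : RiAut k) : RiAut k :=
  mk' φ.toPEquiv.symm
    (fun x y w h => by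
      rw [PEquiv.mem_iff_mem] at h ⊢
      exact φ.map_append y x w h)
    (by simp only [PEquiv.mem_iff_mem]; exact φ.im_criterion.2.1)
    (by simp only [PEquiv.mem_iff_mem]; exact φ.im_criterion.2.2)
    (by simp only [PEquiv.mem_iff_mem]; exact φ.dom_criterion.2.1)
    (by simp only [PEquiv.mem_iff_mem]; exact φ.dom_criterion.2.2)

theorem mem_symm {φ : RiAut k} {x y : List (Fin k)} :
    y ∈ φ.symm.toPEquiv x ↔ x ∈ φ.toPEquiv y :=
  PEquiv.mem_iff_mem φ.toPEquiv

theorem comp_total (ψ φ : RiAut k) :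
    (∀ x : List (Fin k), ∃ w, ∃ y, y ∈ (φ.toPEquiv.trans ψ.toPEquiv) (x ++ w)) ∧
    (∃ N : ℕ, ∀ x : List (Fin k), N ≤ x.length →
      ∃ y, y ∈ (φ.toPEquiv.trans ψ.toPEquiv) x) := by
  constructor
  · intro x
    obtain ⟨w, y, hy⟩ := φ.dom_criterion.2.1 x
    obtain ⟨v, z, hz⟩ := ψ.dom_criterion.2.1 y
    refine ⟨w ++ v, z, (PEquiv.mem_trans _ _ _ _).2 ⟨y ++ v, ?_, hz⟩⟩
    rw [← List.append_assoc]
    exact φ.map_append _ _ v hy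
  · obtain ⟨N, hN⟩ := φ.dom_criterion.2.2
    obtain ⟨M, hM⟩ := ψ.dom_criterion.2.2
    obtain ⟨B, hB⟩ := φ.exists_length_bound M
    refine ⟨max N B, fun x hx => ?_⟩
    obtain ⟨y, hy⟩ := hN x (by omega)
    obtain ⟨z, hz⟩ := hM y (hB x y (by omega) hy)
    exact ⟨z, (PEquiv.mem_trans _ _ _ _).2 ⟨y, hy, hz⟩⟩

/-- Multiplication is composition, maps acting on the left: `ψ * φ = ψ ∘ φ`. -/
instance : Mul (RiAut k) :=
  ⟨fun ψ φ => mk' (φ.toPEquiv.trans ψ.toPEquiv)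
    (fun x y w h => by
      obtain ⟨z, h1, h2⟩ := (PEquiv.mem_trans _ _ _ _).1 h
      exact (PEquiv.mem_trans _ _ _ _).2
        ⟨z ++ w, φ.map_append _ _ w h1, ψ.map_append _ _ w h2⟩)
    (comp_total ψ φ).1 (comp_total ψ φ).2
    (fun y => by
      obtain ⟨w, x, h⟩ := (comp_total φ.symm ψ.symm).1 y
      obtain ⟨z, h1, h2⟩ := (PEquiv.mem_trans _ _ _ _).1 h
      exact ⟨w, x, (PEquiv.mem_trans _ _ _ _).2 ⟨z, mem_symm.1 h2, mem_symm.1 h1⟩⟩)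
    (by
      obtain ⟨N, hN⟩ := (comp_total φ.symm ψ.symm).2
      refine ⟨N, fun y hy => ?_⟩
      obtain ⟨x, h⟩ := hN y hy
      obtain ⟨z, h1, h2⟩ := (PEquiv.mem_trans _ _ _ _).1 h
      exact ⟨x, (PEquiv.mem_trans _ _ _ _).2 ⟨z, mem_symm.1 h2, mem_symm.1 h1⟩⟩)⟩

theorem mem_mul {ψ φ : RiAut k} {x z : List (Fin k)} :
    z ∈ (ψ * φ).toPEquiv x ↔ ∃ y, y ∈ φ.toPEquiv x ∧ z ∈ ψ.toPEquiv y :=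
  PEquiv.mem_trans _ _ _ _

/-- The monoid `riAut(k)`. -/
instance : Monoid (RiAut k) where
  mul_assoc a b c := by
    apply ext_mem
    intro x y
    simp only [mem_mul]
    constructor
    · rintro ⟨u, h1, v, h2, h3⟩
      exact ⟨v, ⟨u, h1, h2⟩, h3⟩
    · rintro ⟨v, ⟨u, h1, h2⟩, h3⟩
      exact ⟨u, h1, v, h2, h3⟩
  one_mul a := by
    apply ext_mem
    intro x y
    rw [mem_mul]
    simp only [mem_one]
    exact ⟨fun ⟨_, h, e⟩ => e ▸ h, fun h => ⟨y, h, rfl⟩⟩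
  mul_one a := by
    apply ext_mem
    intro x y
    rw [mem_mul]
    simp only [mem_one]
    exact ⟨fun ⟨_, e, h⟩ => e ▸ h, fun h => ⟨x, rfl, h⟩⟩

/-- `φ.IsExtendedBy ψ`: `ψ` is an (essential) extension of `φ`. -/
def IsExtendedBy (φ ψ : RiAut k) : Prop :=
  ∀ x y : List (Fin k), y ∈ φ.toPEquiv x → y ∈ ψ.toPEquiv x

theorem mem_unique {φ : RiAut k} {x y z : List (Fin k)} (h1 : y ∈ φ.toPEquiv x)
    (h2 : z ∈ φ.toPEquiv x) : y = z :=
  Option.mem_unique h1 h2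

theorem mem_inj {φ : RiAut k} {x y z : List (Fin k)} (h1 : z ∈ φ.toPEquiv x)
    (h2 : z ∈ φ.toPEquiv y) : x = y :=
  PEquiv.inj φ.toPEquiv h1 h2

/-- `y` is the value at `x` of the maximal extension of `φ`. -/
def MaxRel (φ : RiAut k) (x y : List (Fin k)) : Prop :=
  ∀ w z : List (Fin k), z ∈ φ.toPEquiv (x ++ w) → z = y ++ w

theorem MaxRel.of_mem {φ : RiAut k} {x y : List (Fin k)} (h : y ∈ φ.toPEquiv x) :
    φ.MaxRel x y :=
  fun w _ hz => mem_unique hz (φ.map_append x y w h)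

theorem MaxRel.unique {φ : RiAut k} {x y z : List (Fin k)} (h1 : φ.MaxRel x y)
    (h2 : φ.MaxRel x z) : y = z := by
  obtain ⟨w, u, hu⟩ := φ.dom_criterion.2.1 x
  exact List.append_cancel_right ((h1 w u hu).symm.trans (h2 w u hu))

theorem MaxRel.inj {φ : RiAut k} {x y z : List (Fin k)} (h1 : φ.MaxRel x z)
    (h2 : φ.MaxRel y z) : x = y := by
  obtain ⟨w, u, hu⟩ := φ.dom_criterion.2.1 x
  obtain ⟨v, t, ht⟩ := φ.dom_criterion.2.1 (y ++ w)
  have hu' := φ.map_append _ _ v hu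
  rw [List.append_assoc] at hu' ht
  have e1 := h1 _ _ hu'
  have e2 := h2 _ _ ht
  rw [e1] at hu'
  rw [e2] at ht
  exact List.append_cancel_right (mem_inj hu' ht)

open Classical in
/-- The partial injection underlying the maximal extension. -/
noncomputable def maxPEquiv (φ : RiAut k) : List (Fin k) ≃. List (Fin k) where
  toFun x := if h : ∃ y, φ.MaxRel x y then some h.choose else none
  invFun y := if h : ∃ x, φ.MaxRel x y then some h.choose else none
  inv x y := by
    constructor
    · intro h
      split_ifs at h with hx
      · obtain rfl := Option.some.inj h
        have hy : ∃ y', φ.MaxRel hx.choose y' := ⟨y, hx.choose_spec⟩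
        rw [dif_pos hy]
        exact congrArg some (hy.choose_spec.unique hx.choose_spec)
    · intro h
      split_ifs at h with hx
      · obtain rfl := Option.some.inj h
        have hy : ∃ x', φ.MaxRel x' hx.choose := ⟨x, hx.choose_spec⟩
        rw [dif_pos hy]
        exact congrArg some (hy.choose_spec.inj hx.choose_spec)

theorem mem_maxPEquiv {φ : RiAut k} {x y : List (Fin k)} :
    y ∈ φ.maxPEquiv x ↔ φ.MaxRel x y := by
  classical
  change (if h : ∃ y, φ.MaxRel x y then some h.choose else none) = some y ↔ _
  constructor
  · intro h
    split_ifs at h with hx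
    obtain rfl := Option.some.inj h
    exact hx.choose_spec
  · intro h
    have hx : ∃ y, φ.MaxRel x y := ⟨y, h⟩
    rw [dif_pos hx]
    exact congrArg some (hx.choose_spec.unique h)

/-- The maximal essential extension `max(φ)`. It is the greatest extension of `φ`; see
`isExtendedBy_maxExt` and `isExtendedBy_maxExt_of_isExtendedBy`. -/
noncomputable def maxExt (φ : RiAut k) : RiAut k :=
  mk' φ.maxPEquiv
    (fun x y w h => by
      rw [mem_maxPEquiv] at h ⊢
      intro v z hz
      rw [List.append_assoc] at hz ⊢
      exact h _ _ hz)
    (fun x => by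
      obtain ⟨w, y, hy⟩ := φ.dom_criterion.2.1 x
      exact ⟨w, y, mem_maxPEquiv.2 (.of_mem hy)⟩)
    (by
      obtain ⟨N, hN⟩ := φ.dom_criterion.2.2
      refine ⟨N, fun x hx => ?_⟩
      obtain ⟨y, hy⟩ := hN x hx
      exact ⟨y, mem_maxPEquiv.2 (.of_mem hy)⟩)
    (fun y => by
      obtain ⟨w, x, hy⟩ := φ.im_criterion.2.1 y
      exact ⟨w, x, mem_maxPEquiv.2 (.of_mem hy)⟩)
    (by
      obtain ⟨N, hN⟩ := φ.im_criterion.2.2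
      refine ⟨N, fun y hx => ?_⟩
      obtain ⟨x, hy⟩ := hN y hx
      exact ⟨x, mem_maxPEquiv.2 (.of_mem hy)⟩)

theorem mem_maxExt {φ : RiAut k} {x y : List (Fin k)} :
    y ∈ φ.maxExt.toPEquiv x ↔ φ.MaxRel x y :=
  mem_maxPEquiv

theorem isExtendedBy_maxExt (φ : RiAut k) : φ.IsExtendedBy φ.maxExt :=
  fun _ _ h => mem_maxExt.2 (.of_mem h)

theorem isExtendedBy_maxExt_of_isExtendedBy {φ ψ : RiAut k} (h : φ.IsExtendedBy ψ) :
    ψ.IsExtendedBy φ.maxExt :=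
  fun x y hy => mem_maxExt.2 fun w _ hz =>
    mem_unique (h _ _ hz) (ψ.map_append x y w hy)

theorem IsExtendedBy.antisymm {φ ψ : RiAut k} (h1 : φ.IsExtendedBy ψ) (h2 : ψ.IsExtendedBy φ) :
    φ = ψ :=
  ext_mem fun x y => ⟨h1 x y, h2 x y⟩

theorem maxExt_eq_of_isExtendedBy {φ ψ : RiAut k} (h : φ.IsExtendedBy ψ) :
    φ.maxExt = ψ.maxExt := by
  have h1 : φ.IsExtendedBy ψ.maxExt := fun x y hy => isExtendedBy_maxExt ψ x y (h x y hy)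
  exact IsExtendedBy.antisymm
    (isExtendedBy_maxExt_of_isExtendedBy (isExtendedBy_maxExt_of_isExtendedBy h))
    (isExtendedBy_maxExt_of_isExtendedBy h1)

theorem IsExtendedBy.mul {a b c d : RiAut k} (h1 : a.IsExtendedBy b) (h2 : c.IsExtendedBy d) :
    (a * c).IsExtendedBy (b * d) := by
  intro x z hz
  obtain ⟨y, hy, hz⟩ := mem_mul.1 hz
  exact mem_mul.2 ⟨y, h2 _ _ hy, h1 _ _ hz⟩

theorem maxExt_mul (ψ φ : RiAut k) : (ψ.maxExt * φ.maxExt).maxExt = (ψ * φ).maxExt :=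
  (maxExt_eq_of_isExtendedBy
    ((isExtendedBy_maxExt ψ).mul (isExtendedBy_maxExt φ))).symm

theorem maxExt_maxExt (φ : RiAut k) : φ.maxExt.maxExt = φ.maxExt :=
  (maxExt_eq_of_isExtendedBy (isExtendedBy_maxExt φ)).symm

theorem symm_mul_isExtendedBy_one (φ : RiAut k) : (φ.symm * φ).IsExtendedBy 1 := by
  intro x z hz
  obtain ⟨y, hy, hz⟩ := mem_mul.1 hz
  exact mem_one.2 (mem_inj hy (mem_symm.1 hz))

end RiAut

/-- The Thompson-Higman group `G_{k,1}`: the set of all maximal extensions `max(φ)`. -/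
def ThompsonHigman (k : ℕ) : Type := {g : RiAut k // ∃ φ : RiAut k, φ.maxExt = g}

namespace ThompsonHigman

variable {k : ℕ}

/-- The domain of an element of `G_{k,1}`, in maximally extended form. -/
def Dom (g : ThompsonHigman k) : Set (List (Fin k)) := g.1.Dom

/-- The map `η : riAut(k) → G_{k,1}`, `φ ↦ max(φ)`, on underlying sets. -/
noncomputable def ofRiAut (φ : RiAut k) : ThompsonHigman k := ⟨φ.maxExt, φ, rfl⟩

theorem ofRiAut_val (g : ThompsonHigman k) : ofRiAut g.1 = g := by
  obtain ⟨_, φ, rfl⟩ := g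
  exact Subtype.ext (RiAut.maxExt_maxExt φ)

noncomputable instance : One (ThompsonHigman k) := ⟨ofRiAut 1⟩

/-- Multiplication is composition followed by maximal extension. -/
noncomputable instance : Mul (ThompsonHigman k) := ⟨fun ψ φ => ofRiAut (ψ.1 * φ.1)⟩

noncomputable instance : Inv (ThompsonHigman k) := ⟨fun φ => ofRiAut φ.1.symm⟩

theorem ofRiAut_mul (ψ φ : RiAut k) : ofRiAut (ψ * φ) = ofRiAut ψ * ofRiAut φ :=
  Subtype.ext (RiAut.maxExt_mul ψ φ).symm

theorem ofRiAut_one : ofRiAut (1 : RiAut k) = 1 := rfl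

noncomputable instance : Group (ThompsonHigman k) :=
  Group.ofLeftAxioms
    (fun a b c => by
      rw [← ofRiAut_val a, ← ofRiAut_val b, ← ofRiAut_val c]
      simp only [← ofRiAut_mul, mul_assoc])
    (fun a => by
      rw [← ofRiAut_val a, ← ofRiAut_one, ← ofRiAut_mul, one_mul])
    (fun a => by
      change ofRiAut a.1.symm * a = 1
      conv_lhs => rw [← ofRiAut_val a]
      rw [ofRiAut_val a]
      conv_lhs => rw [← ofRiAut_val a, ← ofRiAut_mul, ofRiAut_val a]
      exact Subtype.ext
        (RiAut.maxExt_eq_of_isExtendedBy (RiAut.symm_mul_isExtendedBy_one a.1)))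

/-- The homomorphism `η : riAut(k) → G_{k,1}`, `φ ↦ max(φ)`. -/
noncomputable def eta (k : ℕ) : RiAut k →* ThompsonHigman k where
  toFun := ofRiAut
  map_one' := ofRiAut_one
  map_mul' := ofRiAut_mul

/-- `g` is given by the finite table `L`: each pair `(u, v)` in `L` contributes `u w ↦ v w`. -/
def HasTable (g : ThompsonHigman k) (L : List (List (Fin k) × List (Fin k))) : Prop :=
  ∀ x y : List (Fin k),
    y ∈ g.1.toPEquiv x ↔ ∃ p ∈ L, ∃ w : List (Fin k), x = p.1 ++ w ∧ y = p.2 ++ w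

end ThompsonHigman

/-- Pairs `(x, S)` with `S` a finite subset of the monoid `M` containing `x` and `1`. -/
@[ext]
structure SuffixPair (M : Type*) [Monoid M] where
  elt : M
  set : Set M
  finite : set.Finite
  elt_mem : elt ∈ set
  one_mem : (1 : M) ∈ set

namespace SuffixPair

variable {M : Type*} [Monoid M]

/-- The multiplication is that of the left semidirect product of `M` with the semilattice of its
finite subsets under union: `(y, T) (x, S) = (y x, T x ∪ S)`. The identity is `(1, {1})`. -/
instance : Monoid (SuffixPair M) where
  mul p q :=
    { elt := p.elt * q.elt
      set := (fun t => t * q.elt) '' p.set ∪ q.set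
      finite := (p.finite.image _).union q.finite
      elt_mem := Or.inl ⟨p.elt, p.elt_mem, rfl⟩
      one_mem := Or.inr q.one_mem }
  one := ⟨1, {1}, Set.finite_singleton 1, rfl, rfl⟩
  mul_assoc p q r := by
    apply SuffixPair.ext
    · exact mul_assoc p.elt q.elt r.elt
    · change (fun t => t * r.elt) '' ((fun t => t * q.elt) '' p.set ∪ q.set) ∪ r.set
        = (fun t => t * (q.elt * r.elt)) '' p.set ∪ ((fun t => t * r.elt) '' q.set ∪ r.set)
      rw [Set.image_union, Set.image_image, Set.union_assoc]
      simp only [mul_assoc]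
  one_mul p := by
    apply SuffixPair.ext
    · exact one_mul p.elt
    · change (fun t => t * p.elt) '' {1} ∪ p.set = p.set
      rw [Set.image_singleton, one_mul]
      exact Set.union_eq_right.2 (Set.singleton_subset_iff.2 p.elt_mem)
  mul_one p := by
    apply SuffixPair.ext
    · exact mul_one p.elt
    · change (fun t => t * 1) '' p.set ∪ {1} = p.set
      simp only [mul_one, Set.image_id']
      exact Set.union_eq_left.2 (Set.singleton_subset_iff.2 p.one_mem)

/-- The element `(γ, {γ, 1})`. -/
def gen (γ : M) : SuffixPair M :=
  ⟨γ, {γ, 1}, by simp, by simp, by simp⟩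

end SuffixPair

/-- The `Γ`-generated suffix expansion of `M`: the submonoid generated by the `(γ, {γ, 1})` with
`γ ∈ Γ`. -/
def suffixExpansion {M : Type*} [Monoid M] (Γ : Set M) : Submonoid (SuffixPair M) :=
  Submonoid.closure (SuffixPair.gen '' Γ)

/-- The map `e(φ) = (η(φ), Dom(φ))`. -/
noncomputable def eMap {k : ℕ} (φ : RiAut k) : ThompsonHigman k × Set (List (Fin k)) :=
  (ThompsonHigman.eta k φ, φ.Dom)

/-- The map `ρ(g, S) = (g, ⋂ h ∈ S, Dom(h))` on the `Γ`-generated suffix expansion of `G_{k,1}`. -/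
def rhoMap {k : ℕ} (Γ : Set (ThompsonHigman k)) (p : suffixExpansion Γ) :
    ThompsonHigman k × Set (List (Fin k)) :=
  (p.1.elt, ⋂ h ∈ p.1.set, ThompsonHigman.Dom h)

/-- Every element of `Δ` has the same domain as some element of `Γ`. -/
def DomainsMatch {k : ℕ} (Δ : Set (RiAut k)) (Γ : Set (ThompsonHigman k)) : Prop :=
  ∀ δ ∈ Δ, ∃ γ ∈ Γ, δ.Dom = ThompsonHigman.Dom γ

/-- The surjectiveness condition on `Γ`: some generating set of the monoid `riAut(k)` has all
its domains among the domains of the elements of `Γ`. -/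
def SurjectivenessCondition {k : ℕ} (Γ : Set (ThompsonHigman k)) : Prop :=
  ∃ Δ : Set (RiAut k), Submonoid.closure Δ = ⊤ ∧ DomainsMatch Δ Γ

/-- The four elements `A`, `B`, `C`, `π₀` of Cannon, Floyd and Parry, by their tables: the dyadic
interval maps `A`, `B`, `C`, `π₀` of `[0,1)` written on binary expansions. -/
def cannonFloydParry : Set (ThompsonHigman 2) :=
  {g | g.HasTable [([0], [0, 0]), ([1, 0], [0, 1]), ([1, 1], [1])] ∨
    g.HasTable [([0], [0]), ([1, 0], [1, 0, 0]), ([1, 1, 0], [1, 0, 1]), ([1, 1, 1], [1, 1])] ∨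
    g.HasTable [([0], [1, 1]), ([1, 0], [0]), ([1, 1], [1, 0])] ∨
    g.HasTable [([0], [1, 0]), ([1, 0], [0]), ([1, 1], [1, 1])]}

/-! Every essential finitely generated right ideal `R` is the domain of a maximally extended
element: the map `RiAut.caretSwap` that interchanges two children of every caret of `R` cannot be extended.
Adding such elements to `η(Δ)` gives `Γ`. If `ρ` is onto `e(riAut(k))`, then the maps `γ ∈ Γ`
generate `riAut(k)`, because `⋂ h ∈ S, Dom h` is the domain of the composite of the word in `Γ` that
defines `(g, S)`. The condition fails as soon as some letter `a` is in no domain of an element of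
`Γ`, since then no element of `riAut(k)` other than `1` with `a` in its domain is a composite of
maps with the given domains. The Cannon–Floyd–Parry set is such a set, with `a = 1`, and so is the
set of all elements that are not defined at `a`.

For `k = 2` the group is studied through its faithful action on infinite words. It is generated by
the interchanges of two cones (`eq_top_of_forall_isConeSwap`): they permute the leaves of the image
tree, so that a caret is mapped to a caret and the trees can be reduced. The group generated by the
Cannon–Floyd–Parry set moves any two disjoint cones, after a subdivision, to those of `0` and `10`,
which `π₀` interchanges (`exists_mapsCone_pair`), so it contains all these interchanges.

A surjective homomorphism of the suffix expansion onto `riAut(2)` induces a surjective endomorphism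
`α` of `G_{2,1}`, because `G` is the maximal group image of each of its suffix expansions
(`SuffixPair.exists_factorization`), and `α` is injective as `G_{2,1}` is simple
(`eq_top_of_normal`). The interchange `τ` of the cones of `0` and `1` cannot be a composite of maps
that are not defined at both letters, so `α(γ) = τ` for a generator `γ`, and `γ = π₀` since no other
generator is an involution. But `π₀` fixes an open set and `τ` fixes no point, and centralizers
detect this: in that of `π₀`, some `y` of order other than `1` and `2` has all its conjugates
commuting with such a `z` (`exists_commute_conj_cfpP`); in that of `τ`, this never happens
(`exists_not_commute_conj`). -/

/-! ### Right ideals as domains of maximally extended elements -/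

namespace RiAut

variable {k : ℕ}

/-- The element of `riAut(k)` with graph `r`. The conditions on essential right ideals reduce to
the domain and the image of `r` containing all sufficiently long words; the letter `a` serves to
lengthen words. -/
noncomputable def ofRel (r : List (Fin k) → List (Fin k) → Prop)
    (hfun : ∀ x y z, r x y → r x z → y = z) (hinj : ∀ x y z, r x z → r y z → x = y)
    (happ : ∀ x y w, r x y → r (x ++ w) (y ++ w))
    (hdom : ∃ N : ℕ, ∀ x : List (Fin k), N ≤ x.length → ∃ y, r x y)
    (him : ∃ N : ℕ, ∀ y : List (Fin k), N ≤ y.length → ∃ x, r x y)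
    (a : Fin k) : RiAut k := by
  classical
  let f : List (Fin k) ≃. List (Fin k) :=
    { toFun := fun x => if h : ∃ y, r x y then some h.choose else none
      invFun := fun y => if h : ∃ x, r x y then some h.choose else none
      inv := by
        intro x y
        constructor
        · intro h
          split_ifs at h with hx
          · obtain rfl := Option.some.inj h
            have hy : ∃ y', r hx.choose y' := ⟨y, hx.choose_spec⟩
            rw [dif_pos hy]
            exact congrArg some (hfun _ _ _ hy.choose_spec hx.choose_spec)
        · intro h
          split_ifs at h with hx
          · obtain rfl := Option.some.inj h
            have hy : ∃ x', r x' hx.choose := ⟨x, hx.choose_spec⟩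
            rw [dif_pos hy]
            exact congrArg some (hinj _ _ _ hy.choose_spec hx.choose_spec) }
  have hf : ∀ x y, y ∈ f x ↔ r x y := by
    intro x y
    change (if h : ∃ y, r x y then some h.choose else none) = some y ↔ _
    constructor
    · intro h
      split_ifs at h with hx
      obtain rfl := Option.some.inj h
      exact hx.choose_spec
    · intro h
      have hx : ∃ y, r x y := ⟨y, h⟩
      rw [dif_pos hx]
      exact congrArg some (hfun _ _ _ hx.choose_spec h)
  refine mk' f ?_ ?_ ?_ ?_ ?_
  · intro x y w
    simp only [hf]
    exact happ x y w
  · obtain ⟨N, hN⟩ := hdom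
    intro x
    obtain ⟨y, hy⟩ := hN (x ++ List.replicate N a) (by simp)
    exact ⟨_, y, (hf _ _).2 hy⟩
  · simpa only [hf] using hdom
  · obtain ⟨N, hN⟩ := him
    intro y
    obtain ⟨x, hx⟩ := hN (y ++ List.replicate N a) (by simp)
    exact ⟨_, x, (hf _ _).2 hx⟩
  · simpa only [hf] using him

theorem mem_ofRel {r : List (Fin k) → List (Fin k) → Prop} {h1 h2 h3 h4 h5} {a : Fin k}
    {x y : List (Fin k)} : y ∈ (ofRel r h1 h2 h3 h4 h5 a).toPEquiv x ↔ r x y := by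
  classical
  change (if h : ∃ y, r x y then some h.choose else none) = some y ↔ _
  constructor
  · intro h
    split_ifs at h with hx
    obtain rfl := Option.some.inj h
    exact hx.choose_spec
  · intro h
    have hx : ∃ y, r x y := ⟨y, h⟩
    rw [dif_pos hx]
    exact congrArg some (h1 _ _ _ hx.choose_spec h)

/-- `c` is the parent of a caret of the right ideal `R`: all its children are minimal elements
of `R`. -/
def IsCaret (R : Set (List (Fin k))) (c : List (Fin k)) : Prop :=
  c ∉ R ∧ ∀ b : Fin k, c ++ [b] ∈ R

/-- A longest extension of `x` outside `R` is the parent of a caret. -/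
theorem exists_isCaret_append {R : Set (List (Fin k))}
    (hN : ∃ N : ℕ, ∀ x : List (Fin k), N ≤ x.length → x ∈ R) {x : List (Fin k)} (hx : x ∉ R) :
    ∃ u, IsCaret R (x ++ u) := by
  obtain ⟨N, hN⟩ := hN
  have hfin : {u : List (Fin k) | x ++ u ∉ R}.Finite := by
    refine (List.finite_length_le (Fin k) N).subset fun u hu => ?_
    by_contra hlt
    simp only [Set.mem_ofPred_eq] at hu hlt
    exact hu (hN _ (by simp; omega))
  obtain ⟨u, hu, hmax⟩ := Set.exists_max_image _ List.length hfin ⟨[], by simpa using hx⟩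
  refine ⟨u, hu, fun d => ?_⟩
  by_contra hd
  have := hmax (u ++ [d]) (by simpa using hd)
  simp at this

/-- The graph of the map with domain `R` that interchanges the children `c ++ [a]` and
`c ++ [b]` of every caret `c` of `R` and fixes the other minimal elements of `R`. -/
def CaretSwapRel (R : Set (List (Fin k))) (a b : Fin k) (x y : List (Fin k)) : Prop :=
  (∃ c d w, IsCaret R c ∧ x = c ++ d :: w ∧ y = c ++ Equiv.swap a b d :: w) ∨
    (x ∈ R ∧ (¬ ∃ c d w, IsCaret R c ∧ x = c ++ d :: w) ∧ y = x)

theorem IsCaret.eq_of_append_eq {R : Set (List (Fin k))} (hR : IsRightIdeal R)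
    {c c' w w' : List (Fin k)} {d d' : Fin k} (hc : IsCaret R c) (hc' : IsCaret R c')
    (h : c ++ d :: w = c' ++ d' :: w') : c = c' := by
  have key : ∀ {c c' w w' : List (Fin k)} {d d' : Fin k}, IsCaret R c → IsCaret R c' →
      c ++ d :: w = c' ++ d' :: w' → c'.length ≤ c.length := by
    intro c c' w w' d d' hc hc' h
    by_contra hlt
    have h1 : c ++ [d] <+: c' := by
      refine List.prefix_of_prefix_length_le (l₃ := c ++ d :: w) ⟨w, by simp⟩ ?_ (by simp; omega)
      rw [h]
      exact List.prefix_append _ _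
    obtain ⟨v, hv⟩ := h1
    exact hc'.1 (hv ▸ hR _ (hc.2 d) v)
  exact (List.append_inj h (le_antisymm (key hc' hc h.symm) (key hc hc' h))).1

theorem CaretSwapRel.symm {R : Set (List (Fin k))} {a b : Fin k} {x y : List (Fin k)}
    (h : CaretSwapRel R a b x y) : CaretSwapRel R a b y x := by
  rcases h with ⟨c, d, w, hc, rfl, rfl⟩ | ⟨h1, h2, rfl⟩
  · exact Or.inl ⟨c, _, w, hc, rfl, by simp⟩
  · exact Or.inr ⟨h1, h2, rfl⟩

theorem CaretSwapRel.unique {R : Set (List (Fin k))} (hR : IsRightIdeal R) {a b : Fin k}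
    {x y z : List (Fin k)} (h : CaretSwapRel R a b x y) (h' : CaretSwapRel R a b x z) : y = z := by
  rcases h with ⟨c, d, w, hc, hx, rfl⟩ | ⟨h1, h2, rfl⟩
  · rcases h' with ⟨c', d', w', hc', hx', rfl⟩ | ⟨-, h2', -⟩
    · have e := hc.eq_of_append_eq hR hc' (hx.symm.trans hx')
      subst e
      have e2 := List.append_cancel_left (hx.symm.trans hx')
      simp only [List.cons.injEq] at e2
      rw [e2.1, e2.2]
    · exact absurd ⟨c, d, w, hc, hx⟩ h2'
  · rcases h' with ⟨c', d', w', hc', hx', rfl⟩ | ⟨-, -, rfl⟩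
    · exact absurd ⟨c', d', w', hc', hx'⟩ h2
    · rfl

theorem CaretSwapRel.append {R : Set (List (Fin k))} (hR : IsRightIdeal R) {a b : Fin k}
    {x y : List (Fin k)} (w : List (Fin k)) (h : CaretSwapRel R a b x y) :
    CaretSwapRel R a b (x ++ w) (y ++ w) := by
  rcases h with ⟨c, d, v, hc, rfl, rfl⟩ | ⟨h1, h2, rfl⟩
  · exact Or.inl ⟨c, d, v ++ w, hc, by simp, by simp⟩
  · refine Or.inr ⟨hR _ h1 w, ?_, rfl⟩
    rintro ⟨c, d, v, hc, hx⟩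
    by_cases hlen : c.length < y.length
    · have h3 : c ++ [d] <+: y :=
        List.prefix_of_prefix_length_le (l₃ := y ++ w) (by rw [hx]; exact ⟨v, by simp⟩)
          (List.prefix_append _ _) (by simp; omega)
      obtain ⟨u, hu⟩ := h3
      exact h2 ⟨c, d, u, hc, by rw [← hu]; simp⟩
    · have h3 : y <+: c :=
        List.prefix_of_prefix_length_le (l₃ := y ++ w) (List.prefix_append _ _)
          (by rw [hx]; exact List.prefix_append _ _) (by omega)
      obtain ⟨u, hu⟩ := h3
      exact hc.1 (hu ▸ hR _ h1 u)

theorem exists_caretSwapRel {R : Set (List (Fin k))} {a b : Fin k} {x : List (Fin k)}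
    (hx : x ∈ R) : ∃ y, CaretSwapRel R a b x y := by
  by_cases h : ∃ c d w, IsCaret R c ∧ x = c ++ d :: w
  · obtain ⟨c, d, w, hc, h⟩ := h
    exact ⟨_, Or.inl ⟨c, d, w, hc, h, rfl⟩⟩
  · exact ⟨x, Or.inr ⟨hx, h, rfl⟩⟩

theorem CaretSwapRel.mem {R : Set (List (Fin k))} (hR : IsRightIdeal R) {a b : Fin k}
    {x y : List (Fin k)} (h : CaretSwapRel R a b x y) : x ∈ R := by
  rcases h with ⟨c, d, v, hc, rfl, rfl⟩ | ⟨h1, -, -⟩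
  · simpa using hR _ (hc.2 d) v
  · exact h1

/-- The involution of the right ideal `R` that interchanges two children of every caret of `R`.
It has no proper extension when the two letters are different. -/
noncomputable def caretSwap (R : Set (List (Fin k))) (hR : IsRightIdeal R)
    (hN : ∃ N : ℕ, ∀ x : List (Fin k), N ≤ x.length → x ∈ R) (a b : Fin k) : RiAut k :=
  ofRel (CaretSwapRel R a b) (fun _ _ _ => CaretSwapRel.unique hR)
    (fun _ _ _ h h' => CaretSwapRel.unique hR h.symm h'.symm)
    (fun _ _ w h => h.append hR w)
    (hN.imp fun _ hN x hx => exists_caretSwapRel (hN x hx))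
    (hN.imp fun _ hN x hx => (exists_caretSwapRel (hN x hx)).imp fun _ => CaretSwapRel.symm) a

section caretSwap

variable {R : Set (List (Fin k))} {hR : IsRightIdeal R}
  {hN : ∃ N : ℕ, ∀ x : List (Fin k), N ≤ x.length → x ∈ R} {a b : Fin k}

theorem dom_caretSwap : (caretSwap R hR hN a b).Dom = R := by
  ext x
  constructor
  · rintro ⟨y, hy⟩
    exact (mem_ofRel.1 hy).mem hR
  · intro hx
    obtain ⟨y, hy⟩ := exists_caretSwapRel (a := a) (b := b) hx
    exact ⟨y, mem_ofRel.2 hy⟩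

theorem caretSwap_mem_iff_comm {x y : List (Fin k)} :
    y ∈ (caretSwap R hR hN a b).toPEquiv x ↔ x ∈ (caretSwap R hR hN a b).toPEquiv y := by
  simp only [caretSwap, mem_ofRel]
  exact ⟨CaretSwapRel.symm, CaretSwapRel.symm⟩

theorem caretSwap_mem_of_isCaret {c : List (Fin k)} (hc : IsCaret R c) :
    c ++ [b] ∈ (caretSwap R hR hN a b).toPEquiv (c ++ [a]) :=
  mem_ofRel.2 (Or.inl ⟨c, a, [], hc, rfl, by simp⟩)

/-- Above a word outside `R` there is a caret of `R`, and the two interchanged letters prevent an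
extension to the parent of this caret. -/
theorem maxExt_caretSwap (hab : a ≠ b) :
    (caretSwap R hR hN a b).maxExt = caretSwap R hR hN a b := by
  refine IsExtendedBy.antisymm (fun x y hy => ?_) (isExtendedBy_maxExt _)
  by_cases hx : x ∈ R
  · rw [← dom_caretSwap (hR := hR) (hN := hN) (a := a) (b := b)] at hx
    obtain ⟨z, hz⟩ := hx
    rwa [mem_unique hy (isExtendedBy_maxExt _ _ _ hz)]
  · exfalso
    obtain ⟨u, hc⟩ := exists_isCaret_append hN hx
    have h1 := caretSwap_mem_of_isCaret (hR := hR) (hN := hN) (a := a) (b := b) hc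
    rw [List.append_assoc] at h1
    have h2 := mem_maxExt.1 hy _ _ h1
    have h3 := congrArg List.getLast? h2
    simp at h3
    exact hab h3.symm

end caretSwap

theorem isRightIdeal_length (n : ℕ) : IsRightIdeal {x : List (Fin k) | n ≤ x.length} := by
  intro x hx w
  simp only [Set.mem_ofPred_eq, List.length_append] at hx ⊢
  omega

end RiAut

namespace ThompsonHigman

variable {k : ℕ}

theorem maxExt_val (g : ThompsonHigman k) : g.1.maxExt = g.1 :=
  congrArg Subtype.val (ofRiAut_val g)

theorem eta_val (g : ThompsonHigman k) : eta k g.1 = g := ofRiAut_val g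

theorem eta_surjective : Function.Surjective (eta k) := fun g => ⟨g.1, eta_val g⟩

theorem mem_of_forall {g : ThompsonHigman k} {x y : List (Fin k)} (h : g.1.MaxRel x y) :
    y ∈ g.1.toPEquiv x := by
  rw [← maxExt_val g]
  exact RiAut.mem_maxExt.2 h

theorem mem_mul {g h : ThompsonHigman k} {x y z : List (Fin k)} (h1 : y ∈ h.1.toPEquiv x)
    (h2 : z ∈ g.1.toPEquiv y) : z ∈ (g * h).1.toPEquiv x :=
  RiAut.isExtendedBy_maxExt _ _ _ (RiAut.mem_mul.2 ⟨y, h1, h2⟩)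

theorem mem_inv {g : ThompsonHigman k} {x y : List (Fin k)} :
    y ∈ (g⁻¹).1.toPEquiv x ↔ x ∈ g.1.toPEquiv y := by
  have key : ∀ {g : ThompsonHigman k} {x y : List (Fin k)}, x ∈ g.1.toPEquiv y →
      y ∈ (g⁻¹).1.toPEquiv x := fun h =>
    RiAut.isExtendedBy_maxExt _ _ _ (RiAut.mem_symm.2 h)
  refine ⟨fun h => ?_, key⟩
  have := key h
  rwa [inv_inv] at this

theorem dom_one : Dom (1 : ThompsonHigman k) = Set.univ :=
  Set.eq_univ_of_forall fun x =>
    Exists.intro x (RiAut.isExtendedBy_maxExt _ _ _ (RiAut.mem_one.2 rfl))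

/-- Every essential finitely generated right ideal is the domain of an element of `G_{k,1}`. -/
theorem exists_dom_eq {a b : Fin k} (hab : a ≠ b) (φ : RiAut k) :
    ∃ γ : ThompsonHigman k, φ.Dom = Dom γ := by
  refine ⟨⟨RiAut.caretSwap φ.Dom φ.dom_criterion.1 φ.dom_criterion.2.2 a b, _,
    RiAut.maxExt_caretSwap hab⟩, ?_⟩
  exact (RiAut.dom_caretSwap (hR := φ.dom_criterion.1) (hN := φ.dom_criterion.2.2)).symm

/-! ### Generating sets and the surjectiveness condition -/

theorem exists_generators_domainsMatch {a b : Fin k} (hab : a ≠ b) {Δ : Set (RiAut k)}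
    (hΔ : Submonoid.closure Δ = ⊤) :
    ∃ Γ : Set (ThompsonHigman k), Submonoid.closure Γ = ⊤ ∧ DomainsMatch Δ Γ ∧
      (Δ.Finite → Γ.Finite ∧ Γ.ncard ≤ 2 * Δ.ncard) := by
  choose f hf using exists_dom_eq (k := k) hab
  refine ⟨eta k '' Δ ∪ f '' Δ, ?_, fun δ hδ => ⟨f δ, Or.inr ⟨δ, hδ, rfl⟩, hf δ⟩, fun h => ?_⟩
  · rw [eq_top_iff]
    refine le_trans ?_ (Submonoid.closure_mono Set.subset_union_left)
    rw [← MonoidHom.map_mclosure, hΔ, ← MonoidHom.mrange_eq_map,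
      MonoidHom.mrange_eq_top.2 eta_surjective]
  · refine ⟨(h.image _).union (h.image _), (Set.ncard_union_le _ _).trans ?_⟩
    have h1 := Set.ncard_image_le (f := eta k) h
    have h2 := Set.ncard_image_le (f := f) h
    omega

theorem surjectivenessCondition_univ {a b : Fin k} (hab : a ≠ b) :
    SurjectivenessCondition (Set.univ : Set (ThompsonHigman k)) :=
  ⟨Set.univ, Submonoid.closure_univ, fun δ _ =>
    (exists_dom_eq hab δ).imp fun _ h => ⟨Set.mem_univ _, h⟩⟩

/-- If `x` is in the domain of `h`, the maximal extension of `g ∘ h` is defined at `x` only if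
`g` is defined at `h x`, since `g` extends `(g h) ∘ h⁻¹`. -/
theorem mem_dom_mul_iff {g h : ThompsonHigman k} {x y : List (Fin k)}
    (hy : y ∈ h.1.toPEquiv x) : x ∈ Dom (g * h) ↔ y ∈ Dom g := by
  constructor
  · rintro ⟨z, hz⟩
    have := mem_mul (mem_inv.2 hy) hz
    rw [mul_inv_cancel_right] at this
    exact ⟨z, this⟩
  · rintro ⟨z, hz⟩
    exact ⟨z, mem_mul hy hz⟩

/-- The pair `(g, S) ∈ (G_{k,1})_Γ` is a word `γₙ ⋯ γ₁`, and `⋂ h ∈ S, Dom h` is the domain of the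
composite `γₙ ∘ ⋯ ∘ γ₁` in `riAut(k)`. -/
theorem exists_mem_closure_of_mem_suffixExpansion {Γ : Set (ThompsonHigman k)}
    {p : SuffixPair (ThompsonHigman k)} (hp : p ∈ suffixExpansion Γ) :
    ∃ ψ ∈ Submonoid.closure (Subtype.val '' Γ : Set (RiAut k)),
      eta k ψ = p.elt ∧ ψ.Dom = ⋂ h ∈ p.set, Dom h := by
  induction hp using Submonoid.closure_induction with
  | mem p hp =>
    obtain ⟨γ, hγ, rfl⟩ := hp
    refine ⟨γ.1, Submonoid.subset_closure ⟨γ, hγ, rfl⟩, eta_val γ, ?_⟩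
    change γ.1.Dom = ⋂ h ∈ ({γ, 1} : Set (ThompsonHigman k)), Dom h
    rw [Set.biInter_pair, dom_one, Set.inter_univ]
    rfl
  | one =>
    refine ⟨1, one_mem _, map_one _, ?_⟩
    change (1 : RiAut k).Dom = ⋂ h ∈ ({1} : Set (ThompsonHigman k)), Dom h
    rw [Set.biInter_singleton, dom_one]
    exact Set.eq_univ_of_forall fun x => Exists.intro x (RiAut.mem_one.2 rfl)
  | mul p q _ _ ihp ihq =>
    obtain ⟨ψ, hψ, e1, d1⟩ := ihp
    obtain ⟨φ, hφ, e2, d2⟩ := ihq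
    refine ⟨ψ * φ, mul_mem hψ hφ, by rw [map_mul, e1, e2]; rfl, ?_⟩
    have hφq : φ.IsExtendedBy q.elt.1 := by
      rw [← e2]
      exact RiAut.isExtendedBy_maxExt φ
    change _ = ⋂ h ∈ (fun t => t * q.elt) '' p.set ∪ q.set, Dom h
    rw [Set.biInter_union, ← d2, Set.biInter_image]
    ext x
    constructor
    · rintro ⟨z, hz⟩
      obtain ⟨y, hy, hz⟩ := RiAut.mem_mul.1 hz
      refine ⟨?_, y, hy⟩
      have hyD : y ∈ ψ.Dom := ⟨z, hz⟩
      rw [d1] at hyD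
      simp only [Set.mem_iInter] at hyD ⊢
      exact fun t ht => (mem_dom_mul_iff (hφq _ _ hy)).2 (hyD t ht)
    · rintro ⟨h1, y, hy⟩
      have hyD : y ∈ ψ.Dom := by
        rw [d1]
        simp only [Set.mem_iInter] at h1 ⊢
        exact fun t ht => (mem_dom_mul_iff (hφq _ _ hy)).1 (h1 t ht)
      obtain ⟨z, hz⟩ := hyD
      exact ⟨z, RiAut.mem_mul.2 ⟨y, hy, hz⟩⟩

/-- The map `e` is injective. -/
theorem eq_of_eta_eq_of_dom_eq {φ ψ : RiAut k} (h : eta k φ = eta k ψ) (hd : φ.Dom = ψ.Dom) :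
    φ = ψ := by
  have key : ∀ {φ ψ : RiAut k}, eta k φ = eta k ψ → φ.Dom = ψ.Dom → φ.IsExtendedBy ψ := by
    intro φ ψ h hd x y hy
    have hx : x ∈ ψ.Dom := hd ▸ ⟨y, hy⟩
    obtain ⟨z, hz⟩ := hx
    have h1 : φ.maxExt = ψ.maxExt := congrArg Subtype.val h
    have h2 := RiAut.isExtendedBy_maxExt _ _ _ hy
    rw [h1] at h2
    rwa [RiAut.mem_unique h2 (RiAut.isExtendedBy_maxExt _ _ _ hz)]
  exact RiAut.IsExtendedBy.antisymm (key h hd) (key h.symm hd.symm)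

theorem surjectivenessCondition_of_range_subset {Γ : Set (ThompsonHigman k)}
    (h : Set.range (eMap (k := k)) ⊆ Set.range (rhoMap Γ)) : SurjectivenessCondition Γ := by
  refine ⟨Subtype.val '' Γ, ?_, ?_⟩
  · rw [eq_top_iff]
    intro φ _
    obtain ⟨⟨p, hp⟩, hpφ⟩ := h (Set.mem_range_self φ)
    obtain ⟨ψ, hψ, h1, h2⟩ := exists_mem_closure_of_mem_suffixExpansion hp
    have e := Prod.mk.inj hpφ
    rwa [← eq_of_eta_eq_of_dom_eq (h1.trans e.1) (h2.trans e.2)]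
  · rintro _ ⟨γ, hγ, rfl⟩
    exact ⟨γ, hγ, rfl⟩

/-- A composite of elements of `riAut(k)` without `a` in their domains is `1` or does not have `a`
in its domain, whereas some `φ ≠ 1` has the set of all nonempty words as its domain. -/
theorem not_surjectivenessCondition (a : Fin k) {Γ : Set (ThompsonHigman k)}
    (hΓ : ∀ γ ∈ Γ, [a] ∉ Dom γ) : ¬ SurjectivenessCondition Γ := by
  rintro ⟨Δ, hΔ, hm⟩
  have key : ∀ φ ∈ Submonoid.closure Δ, φ = 1 ∨ [a] ∉ φ.Dom := by
    intro φ hφ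
    induction hφ using Submonoid.closure_induction with
    | mem δ hδ =>
      obtain ⟨γ, hγ, e⟩ := hm δ hδ
      exact Or.inr (e ▸ hΓ γ hγ)
    | one => exact Or.inl rfl
    | mul ψ φ _ _ ihψ ihφ =>
      rcases ihφ with rfl | h
      · simpa using ihψ
      · refine Or.inr fun ⟨z, hz⟩ => h ?_
        obtain ⟨y, hy, -⟩ := RiAut.mem_mul.1 hz
        exact ⟨y, hy⟩
  have hN : ∃ N : ℕ, ∀ x : List (Fin k), N ≤ x.length → x ∈ {x : List (Fin k) | 1 ≤ x.length} :=
    ⟨1, fun _ hx => hx⟩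
  have hd := RiAut.dom_caretSwap (hR := RiAut.isRightIdeal_length 1) (hN := hN) (a := a) (b := a)
  rcases key (RiAut.caretSwap _ (RiAut.isRightIdeal_length 1) hN a a)
    (hΔ ▸ Submonoid.mem_top _) with h | h
  · rw [h] at hd
    have : ([] : List (Fin k)) ∈ (1 : RiAut k).Dom := ⟨[], RiAut.mem_one.2 rfl⟩
    rw [hd] at this
    simp at this
  · rw [hd] at h
    simp at h

/-- The elements without the letter `a` in their domains generate `G_{k,1}`: if `g` is defined at
`a` and `h` interchanges the words `c a` and `c b` for all letters `c`, then neither `g h` nor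
`h⁻¹` is defined at `a`. -/
theorem exists_generators_not_surjectivenessCondition {a b : Fin k} (hab : a ≠ b) :
    ∃ Γ : Set (ThompsonHigman k), Submonoid.closure Γ = ⊤ ∧ ¬ SurjectivenessCondition Γ := by
  refine ⟨{g | [a] ∉ Dom g}, ?_, not_surjectivenessCondition a fun _ h => h⟩
  have hN : ∃ N : ℕ, ∀ x : List (Fin k), N ≤ x.length → x ∈ {x : List (Fin k) | 2 ≤ x.length} :=
    ⟨2, fun _ hx => hx⟩
  let φ : RiAut k := RiAut.caretSwap _ (RiAut.isRightIdeal_length 2) hN a b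
  let h : ThompsonHigman k := ⟨φ, φ, RiAut.maxExt_caretSwap hab⟩
  have hcaret : RiAut.IsCaret {x : List (Fin k) | 2 ≤ x.length} [a] := by
    constructor <;> simp
  have hda : [a] ∉ φ.Dom := by
    rw [RiAut.dom_caretSwap]
    simp
  have hinv : [a] ∉ Dom h⁻¹ := by
    rintro ⟨y, hy⟩
    exact hda ⟨y, RiAut.caretSwap_mem_iff_comm.1 (mem_inv.1 hy)⟩
  have hab' : [a, b] ∈ h.1.toPEquiv [a, a] :=
    RiAut.caretSwap_mem_of_isCaret (hR := RiAut.isRightIdeal_length 2) (hN := hN) hcaret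
  rw [eq_top_iff]
  intro g _
  by_cases hg : [a] ∈ Dom g
  · rw [← mul_inv_cancel_right g h]
    refine mul_mem (Submonoid.subset_closure ?_) (Submonoid.subset_closure hinv)
    rintro ⟨v, hv⟩
    obtain ⟨u, hu⟩ := hg
    -- `g h` would send `a a` both to `v a` and to `u b`
    have h1 := (g * h).1.map_append _ _ [a] hv
    have h2 := mem_mul hab' (g.1.map_append _ _ [b] hu)
    have h3 := congrArg List.getLast? (RiAut.mem_unique h1 h2)
    simp at h3
    exact hab h3
  · exact Submonoid.subset_closure hg

end ThompsonHigman

/-! ### The action of `G_{k,1}` on infinite words -/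

namespace Stream'

/-- The cone of infinite words with prefix `u`. -/
def cone {α : Type*} (u : List α) : Set (Stream' α) := {x | ∃ t, x = u ++ₛ t}

variable {α : Type*}

theorem append_mem_cone (u : List α) (t : Stream' α) : u ++ₛ t ∈ cone u := ⟨t, rfl⟩

theorem cone_anti {u v : List α} (h : u <+: v) : cone v ⊆ cone u := by
  obtain ⟨w, rfl⟩ := h
  rintro _ ⟨t, rfl⟩
  exact ⟨w ++ₛ t, append_append_stream u w t⟩

theorem append_right_injective' (u : List α) {s t : Stream' α} (h : u ++ₛ s = u ++ₛ t) :
    s = t := by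
  rw [← drop_append_stream u s, h, drop_append_stream]

theorem mem_cone_take (x : Stream' α) (n : ℕ) : x ∈ cone (x.take n) :=
  ⟨x.drop n, (append_take_drop n x).symm⟩

theorem mem_cone_iff_take {u : List α} {x : Stream' α} : x ∈ cone u ↔ x.take u.length = u := by
  constructor
  · rintro ⟨t, rfl⟩
    rw [take_append_of_le_length _ u t le_rfl, List.take_length]
  · intro h
    rw [← h]
    exact mem_cone_take x _

theorem prefix_of_mem_cone {u v : List α} {x : Stream' α} (hu : x ∈ cone u) (hv : x ∈ cone v)
    (h : u.length ≤ v.length) : u <+: v := by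
  rw [mem_cone_iff_take] at hu hv
  rw [← hu, ← hv, ← min_eq_right h, ← take_take]
  exact List.take_prefix _ _

theorem prefix_or_prefix_of_mem_cone {u v : List α} {x : Stream' α} (hu : x ∈ cone u)
    (hv : x ∈ cone v) : u <+: v ∨ v <+: u :=
  (le_total u.length v.length).imp (prefix_of_mem_cone hu hv) (prefix_of_mem_cone hv hu)

theorem take_eq_take_of_mem_cone {n : ℕ} {u : List α} {x y : Stream' α} (hn : n ≤ u.length)
    (hx : x ∈ cone u) (hy : y ∈ cone u) : x.take n = y.take n := by
  obtain ⟨s, rfl⟩ := hx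
  obtain ⟨t, rfl⟩ := hy
  rw [take_append_of_le_length _ _ _ hn, take_append_of_le_length _ _ _ hn]

theorem exists_take_ne {x y : Stream' α} (h : x ≠ y) : ∃ n, x.take n ≠ y.take n := by
  by_contra! h'
  exact h (take_theorem x y h')

theorem eq_of_forall_append_eq {a b : α} (hab : a ≠ b) : ∀ {u v : List α},
    (∀ t, u ++ₛ t = v ++ₛ t) → u = v
  | [], [], _ => rfl
  | [], List.cons c v, h => by
    have h1 := congrArg head (h (const a))
    have h2 := congrArg head (h (const b))
    exact absurd (h1.trans h2.symm) hab
  | List.cons c u, [], h => by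
    have h1 := congrArg head (h (const a))
    have h2 := congrArg head (h (const b))
    exact absurd (h1.symm.trans h2) hab
  | List.cons c u, List.cons d v, h => by
    have h1 : c = d := congrArg head (h (const a))
    have h2 : u = v := eq_of_forall_append_eq hab fun t => congrArg tail (h t)
    rw [h1, h2]

end Stream'

open Stream'

/-- The words `u` and `v` are not prefixes of each other, that is, their cones are disjoint. -/
def Incomparable {α : Type*} (u v : List α) : Prop := ¬ u <+: v ∧ ¬ v <+: u

namespace Incomparable

variable {α : Type*} {u v : List α}

theorem symm (h : Incomparable u v) : Incomparable v u := ⟨h.2, h.1⟩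

theorem disjoint (h : Incomparable u v) : Disjoint (cone u) (cone v) :=
  Set.disjoint_left.2 fun _ hu hv => (prefix_or_prefix_of_mem_cone hu hv).elim h.1 h.2

theorem of_disjoint [Nonempty α] (h : Disjoint (cone u) (cone v)) : Incomparable u v := by
  obtain ⟨a⟩ := ‹Nonempty α›
  constructor
  · intro h1
    exact Set.disjoint_left.1 h (cone_anti h1 (append_mem_cone v (const a)))
      (append_mem_cone v (const a))
  · intro h1
    exact Set.disjoint_left.1 h (append_mem_cone u (const a))
      (cone_anti h1 (append_mem_cone u (const a)))

theorem append (h : Incomparable u v) (x y : List α) : Incomparable (u ++ x) (v ++ y) := by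
  constructor
  · intro h1
    exact (List.prefix_or_prefix_of_prefix ((List.prefix_append u x).trans h1)
      (List.prefix_append v y)).elim h.1 h.2
  · intro h1
    exact (List.prefix_or_prefix_of_prefix ((List.prefix_append v y).trans h1)
      (List.prefix_append u x)).elim h.2 h.1

theorem append_left (h : Incomparable u v) (w : List α) : Incomparable (w ++ u) (w ++ v) := by
  constructor
  · rw [List.prefix_append_right_inj]; exact h.1
  · rw [List.prefix_append_right_inj]; exact h.2

theorem of_length_eq (h : u.length = v.length) (hne : u ≠ v) : Incomparable u v :=
  ⟨fun h1 => hne (h1.eq_of_length h), fun h1 => hne (h1.eq_of_length h.symm).symm⟩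

end Incomparable

namespace RiAut

variable {k : ℕ}

/-- The graph of the map on infinite words induced by `φ`: `u t ↦ φ(u) t` for `u ∈ Dom(φ)`. -/
def ActsTo (φ : RiAut k) (p q : Stream' (Fin k)) : Prop :=
  ∃ u v t, v ∈ φ.toPEquiv u ∧ p = u ++ₛ t ∧ q = v ++ₛ t

theorem ActsTo.unique {φ : RiAut k} {p q q' : Stream' (Fin k)} (h : φ.ActsTo p q)
    (h' : φ.ActsTo p q') : q = q' := by
  have key : ∀ {u v u' v' : List (Fin k)} {t t' : Stream' (Fin k)}, v ∈ φ.toPEquiv u →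
      v' ∈ φ.toPEquiv u' → u ++ₛ t = u' ++ₛ t' → u <+: u' → v ++ₛ t = v' ++ₛ t' := by
    rintro u v u' v' t t' hu hu' e ⟨w, rfl⟩
    rw [append_append_stream] at e
    rw [append_right_injective' u e, mem_unique hu' (φ.map_append _ _ w hu),
      append_append_stream]
  obtain ⟨u, v, t, hu, rfl, rfl⟩ := h
  obtain ⟨u', v', t', hu', e, rfl⟩ := h'
  rcases prefix_or_prefix_of_mem_cone (append_mem_cone u t) ⟨t', e⟩ with h | h
  · exact key hu hu' e h
  · exact (key hu' hu e.symm h).symm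

theorem exists_actsTo (φ : RiAut k) (p : Stream' (Fin k)) : ∃ q, φ.ActsTo p q := by
  obtain ⟨N, hN⟩ := φ.dom_criterion.2.2
  obtain ⟨v, hv⟩ := hN (p.take N) (by simp)
  exact ⟨_, _, v, p.drop N, hv, (append_take_drop N p).symm, rfl⟩

theorem ActsTo.mono {φ ψ : RiAut k} (h : φ.IsExtendedBy ψ) {p q : Stream' (Fin k)}
    (hp : φ.ActsTo p q) : ψ.ActsTo p q := by
  obtain ⟨u, v, t, hu, h1, h2⟩ := hp
  exact ⟨u, v, t, h _ _ hu, h1, h2⟩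

theorem ActsTo.mul {φ ψ : RiAut k} {p q r : Stream' (Fin k)} (h1 : φ.ActsTo p q)
    (h2 : ψ.ActsTo q r) : (ψ * φ).ActsTo p r := by
  obtain ⟨u, v, t, hu, rfl, rfl⟩ := h1
  obtain ⟨N, hN⟩ := (comp_total ψ φ).2
  obtain ⟨z, hz⟩ := hN (u ++ t.take N) (by simp)
  have hz' : z ∈ (ψ * φ).toPEquiv (u ++ t.take N) := hz
  have e : u ++ₛ t = (u ++ t.take N) ++ₛ t.drop N := by
    rw [append_append_stream, append_take_drop]
  refine ⟨_, z, t.drop N, hz, e, ?_⟩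
  obtain ⟨y, hy, hyz⟩ := mem_mul.1 hz'
  obtain rfl := mem_unique hy (φ.map_append _ _ _ hu)
  refine h2.unique ⟨_, z, t.drop N, hyz, ?_, rfl⟩
  rw [append_append_stream, append_take_drop]

end RiAut

namespace ThompsonHigman

variable {k : ℕ}

noncomputable instance : SMul (ThompsonHigman k) (Stream' (Fin k)) :=
  ⟨fun g p => (g.1.exists_actsTo p).choose⟩

theorem actsTo_smul (g : ThompsonHigman k) (p : Stream' (Fin k)) : g.1.ActsTo p (g • p) :=
  (g.1.exists_actsTo p).choose_spec

/-- `G_{k,1}` acts on infinite words by replacing prefixes. -/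
noncomputable instance : MulAction (ThompsonHigman k) (Stream' (Fin k)) where
  one_smul p := (actsTo_smul 1 p).unique
    ⟨[], [], p, RiAut.isExtendedBy_maxExt _ _ _ (RiAut.mem_one.2 rfl), rfl, rfl⟩
  mul_smul g h p := (actsTo_smul (g * h) p).unique
    (((actsTo_smul h p).mul (actsTo_smul g _)).mono (RiAut.isExtendedBy_maxExt _))

/-- `g` maps the cone of `u` onto the cone of `v` by `u t ↦ v t`. For `k ≥ 2` this means that
`u` is in the domain of `g` and `g u = v`; see `mem_of_mapsCone`. -/
def MapsCone (g : ThompsonHigman k) (u v : List (Fin k)) : Prop :=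
  ∀ t : Stream' (Fin k), g • (u ++ₛ t) = v ++ₛ t

theorem mapsCone_of_mem {g : ThompsonHigman k} {u v : List (Fin k)} (h : v ∈ g.1.toPEquiv u) :
    MapsCone g u v :=
  fun t => (actsTo_smul g _).unique ⟨u, v, t, h, rfl, rfl⟩

/-- Maximality of the elements of `G_{k,1}`, in terms of the action. -/
theorem mem_of_mapsCone {a b : Fin k} (hab : a ≠ b) {g : ThompsonHigman k} {u v : List (Fin k)}
    (h : MapsCone g u v) : v ∈ g.1.toPEquiv u := by
  refine mem_of_forall fun w z hz => eq_of_forall_append_eq hab fun t => ?_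
  rw [← mapsCone_of_mem hz t, append_append_stream, append_append_stream, h]

theorem ext_smul {a b : Fin k} (hab : a ≠ b) {g h : ThompsonHigman k}
    (e : ∀ x : Stream' (Fin k), g • x = h • x) : g = h := by
  refine Subtype.ext (RiAut.ext_mem fun x y => ⟨fun hy => ?_, fun hy => ?_⟩)
  · exact mem_of_mapsCone hab fun t => (e _).symm.trans (mapsCone_of_mem hy t)
  · exact mem_of_mapsCone hab fun t => (e _).trans (mapsCone_of_mem hy t)

theorem exists_mapsCone (g : ThompsonHigman k) :
    ∃ N : ℕ, ∀ u : List (Fin k), N ≤ u.length → ∃ v, MapsCone g u v := by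
  obtain ⟨N, hN⟩ := g.1.dom_criterion.2.2
  exact ⟨N, fun u hu => (hN u hu).imp fun _ => mapsCone_of_mem⟩

namespace MapsCone

variable {g h : ThompsonHigman k} {u v w : List (Fin k)}

theorem append (hg : MapsCone g u v) (w : List (Fin k)) : MapsCone g (u ++ w) (v ++ w) := by
  intro t
  rw [append_append_stream, append_append_stream, hg]

theorem mul (hg : MapsCone g v w) (hh : MapsCone h u v) : MapsCone (g * h) u w := by
  intro t
  rw [mul_smul, hh, hg]

theorem inv (hg : MapsCone g u v) : MapsCone g⁻¹ v u := by
  intro t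
  rw [← hg t, inv_smul_smul]

theorem one (u : List (Fin k)) : MapsCone (1 : ThompsonHigman k) u u := fun _ => one_smul _ _

theorem smul_mem (hg : MapsCone g u v) {x : Stream' (Fin k)} (hx : x ∈ cone u) :
    g • x ∈ cone v := by
  obtain ⟨t, rfl⟩ := hx
  exact ⟨t, hg t⟩

theorem smul_mem_iff (hg : MapsCone g u v) {x : Stream' (Fin k)} :
    g • x ∈ cone v ↔ x ∈ cone u :=
  ⟨fun h => by simpa using hg.inv.smul_mem h, hg.smul_mem⟩

theorem incomparable [NeZero k] {u' v' : List (Fin k)} (hg : MapsCone g u v)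
    (hg' : MapsCone g u' v') (hu : Incomparable u u') : Incomparable v v' := by
  refine .of_disjoint (Set.disjoint_left.2 fun x h1 h2 => ?_)
  exact Set.disjoint_left.1 hu.disjoint (hg.inv.smul_mem h1) (hg'.inv.smul_mem h2)

end MapsCone

end ThompsonHigman

namespace ThompsonHigman

/-! ### Elements of `G_{2,1}` given by tables -/

/-- The table `L` defines an element of `G_{2,1}` if its two columns are complete prefix codes and
no pair of siblings is mapped to a pair of siblings in the same order. -/
theorem exists_hasTable (L : List (List (Fin 2) × List (Fin 2))) (N : ℕ)
    (h1 : ∀ p ∈ L, ∀ q ∈ L, p.1 <+: q.1 → p = q) (h2 : ∀ p ∈ L, ∀ q ∈ L, p.2 <+: q.2 → p = q)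
    (h3 : ∀ f : Fin N → Fin 2, ∃ p ∈ L, p.1 <+: List.ofFn f)
    (h4 : ∀ f : Fin N → Fin 2, ∃ p ∈ L, p.2 <+: List.ofFn f)
    (h5 : ∀ p ∈ L, ∀ q ∈ L, p.1.dropLast = q.1.dropLast → p.1.getLast? = some 0 →
      q.1.getLast? = some 1 → p.2.getLast? = some 0 → q.2.getLast? = some 1 →
      p.2.dropLast ≠ q.2.dropLast) :
    ∃ g : ThompsonHigman 2, g.HasTable L := by
  let r : List (Fin 2) → List (Fin 2) → Prop := fun x y =>
    ∃ p ∈ L, ∃ w : List (Fin 2), x = p.1 ++ w ∧ y = p.2 ++ w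
  have htake : ∀ x : List (Fin 2), N ≤ x.length → ∃ f : Fin N → Fin 2, List.ofFn f <+: x := by
    intro x hx
    refine ⟨fun i => x[i], ?_⟩
    have : List.ofFn (fun i : Fin N => x[i]) = x.take N := by
      apply List.ext_getElem
      · simp [hx]
      · simp
    rw [this]
    exact List.take_prefix _ _
  have hdom : ∃ N : ℕ, ∀ x : List (Fin 2), N ≤ x.length → ∃ y, r x y := by
    refine ⟨N, fun x hx => ?_⟩
    obtain ⟨f, hf⟩ := htake x hx
    obtain ⟨p, hp, hpf⟩ := h3 f
    obtain ⟨w, rfl⟩ := hpf.trans hf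
    exact ⟨_, p, hp, w, rfl, rfl⟩
  have him : ∃ N : ℕ, ∀ x : List (Fin 2), N ≤ x.length → ∃ y, r y x := by
    refine ⟨N, fun x hx => ?_⟩
    obtain ⟨f, hf⟩ := htake x hx
    obtain ⟨p, hp, hpf⟩ := h4 f
    obtain ⟨w, rfl⟩ := hpf.trans hf
    exact ⟨_, p, hp, w, rfl, rfl⟩
  let φ : RiAut 2 := RiAut.ofRel r
    (by
      rintro _ _ _ ⟨p, hp, w, rfl, rfl⟩ ⟨q, hq, w', hx, rfl⟩
      have e : p = q := by
        rcases List.prefix_or_prefix_of_prefix (List.prefix_append p.1 w)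
          (hx ▸ List.prefix_append q.1 w') with h | h
        · exact h1 p hp q hq h
        · exact (h1 q hq p hp h).symm
      subst e
      rw [List.append_cancel_left hx])
    (by
      rintro _ _ _ ⟨p, hp, w, rfl, rfl⟩ ⟨q, hq, w', rfl, hx⟩
      have e : p = q := by
        rcases List.prefix_or_prefix_of_prefix (List.prefix_append p.2 w)
          (hx ▸ List.prefix_append q.2 w') with h | h
        · exact h2 p hp q hq h
        · exact (h2 q hq p hp h).symm
      subst e
      rw [List.append_cancel_left hx])
    (by
      rintro _ _ w ⟨p, hp, v, rfl, rfl⟩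
      exact ⟨p, hp, v ++ w, by simp, by simp⟩)
    hdom him 0
  have hφ : ∀ x y, y ∈ φ.toPEquiv x ↔ r x y := fun x y => RiAut.mem_ofRel
  have hmax : φ.maxExt = φ := by
    refine RiAut.IsExtendedBy.antisymm (fun x y hy => ?_) (RiAut.isExtendedBy_maxExt _)
    by_cases hx : x ∈ φ.Dom
    · obtain ⟨z, hz⟩ := hx
      rwa [RiAut.mem_unique hy (RiAut.isExtendedBy_maxExt _ _ _ hz)]
    · exfalso
      obtain ⟨u, hu, hc⟩ := RiAut.exists_isCaret_append φ.dom_criterion.2.2 hx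
      have hrow : ∀ b : Fin 2, (x ++ u ++ [b], y ++ u ++ [b]) ∈ L := by
        intro b
        obtain ⟨z, hz⟩ := hc b
        obtain ⟨p, hp, w, e1, e2⟩ := (hφ _ _).1 hz
        -- `p` is the row of `x u b` itself, since `x u` is outside the domain
        have hw : w = [] := by
          by_contra hw
          refine hu ⟨p.2 ++ w.dropLast, (hφ _ _).2 ⟨p, hp, w.dropLast, ?_, rfl⟩⟩
          have := congrArg List.dropLast e1
          rwa [List.dropLast_concat, List.dropLast_append_of_ne_nil hw] at this
        subst hw
        have e3 := RiAut.mem_maxExt.1 hy (u ++ [b]) z (by rwa [← List.append_assoc])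
        rw [List.append_nil] at e1 e2
        have : p = (x ++ u ++ [b], y ++ u ++ [b]) :=
          Prod.ext e1.symm ((e2.symm.trans e3).trans (List.append_assoc _ _ _).symm)
        exact this ▸ hp
      exact h5 _ (hrow 0) _ (hrow 1) (by simp) (by simp) (by simp) (by simp) (by simp) (by simp)
  exact ⟨⟨φ, φ, hmax⟩, hφ⟩

theorem HasTable.mapsCone {k : ℕ} {g : ThompsonHigman k} {L : List (List (Fin k) × List (Fin k))}
    (h : g.HasTable L) {u v : List (Fin k)} (hp : (u, v) ∈ L) : MapsCone g u v :=
  mapsCone_of_mem ((h _ _).2 ⟨(u, v), hp, [], by simp, by simp⟩)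

theorem HasTable.unique {k : ℕ} {g h : ThompsonHigman k}
    {L : List (List (Fin k) × List (Fin k))} (hg : g.HasTable L) (hh : h.HasTable L) : g = h :=
  Subtype.ext (RiAut.ext_mem fun x y => (hg x y).trans (hh x y).symm)

theorem exists_hasTable_A : ∃ g : ThompsonHigman 2,
    g.HasTable [([0], [0, 0]), ([1, 0], [0, 1]), ([1, 1], [1])] :=
  exists_hasTable _ 2 (by decide) (by decide) (by decide) (by decide) (by decide)

theorem exists_hasTable_B : ∃ g : ThompsonHigman 2, g.HasTable
    [([0], [0]), ([1, 0], [1, 0, 0]), ([1, 1, 0], [1, 0, 1]), ([1, 1, 1], [1, 1])] :=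
  exists_hasTable _ 3 (by decide) (by decide) (by decide) (by decide) (by decide)

theorem exists_hasTable_C : ∃ g : ThompsonHigman 2,
    g.HasTable [([0], [1, 1]), ([1, 0], [0]), ([1, 1], [1, 0])] :=
  exists_hasTable _ 2 (by decide) (by decide) (by decide) (by decide) (by decide)

theorem exists_hasTable_P : ∃ g : ThompsonHigman 2,
    g.HasTable [([0], [1, 0]), ([1, 0], [0]), ([1, 1], [1, 1])] :=
  exists_hasTable _ 2 (by decide) (by decide) (by decide) (by decide) (by decide)

/-- The element `A₀`. -/
noncomputable def cfpA : ThompsonHigman 2 := exists_hasTable_A.choose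

/-- The element `B₀`. -/
noncomputable def cfpB : ThompsonHigman 2 := exists_hasTable_B.choose

/-- The element `C₀`. -/
noncomputable def cfpC : ThompsonHigman 2 := exists_hasTable_C.choose

/-- The element `π₀`. -/
noncomputable def cfpP : ThompsonHigman 2 := exists_hasTable_P.choose

theorem cannonFloydParry_eq : cannonFloydParry = {cfpA, cfpB, cfpC, cfpP} := by
  ext g
  simp only [Set.mem_insert_iff, Set.mem_singleton_iff]
  constructor
  · rintro (h | h | h | h)
    · exact Or.inl (h.unique exists_hasTable_A.choose_spec)
    · exact Or.inr (Or.inl (h.unique exists_hasTable_B.choose_spec))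
    · exact Or.inr (Or.inr (Or.inl (h.unique exists_hasTable_C.choose_spec)))
    · exact Or.inr (Or.inr (Or.inr (h.unique exists_hasTable_P.choose_spec)))
  · rintro (rfl | rfl | rfl | rfl)
    · exact Or.inl exists_hasTable_A.choose_spec
    · exact Or.inr (Or.inl exists_hasTable_B.choose_spec)
    · exact Or.inr (Or.inr (Or.inl exists_hasTable_C.choose_spec))
    · exact Or.inr (Or.inr (Or.inr exists_hasTable_P.choose_spec))

theorem cfpA_0 : MapsCone cfpA [0] [0, 0] := exists_hasTable_A.choose_spec.mapsCone (by simp)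
theorem cfpA_10 : MapsCone cfpA [1, 0] [0, 1] := exists_hasTable_A.choose_spec.mapsCone (by simp)
theorem cfpA_11 : MapsCone cfpA [1, 1] [1] := exists_hasTable_A.choose_spec.mapsCone (by simp)
theorem cfpB_0 : MapsCone cfpB [0] [0] := exists_hasTable_B.choose_spec.mapsCone (by simp)
theorem cfpB_10 : MapsCone cfpB [1, 0] [1, 0, 0] :=
  exists_hasTable_B.choose_spec.mapsCone (by simp)
theorem cfpB_110 : MapsCone cfpB [1, 1, 0] [1, 0, 1] :=
  exists_hasTable_B.choose_spec.mapsCone (by simp)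
theorem cfpB_111 : MapsCone cfpB [1, 1, 1] [1, 1] :=
  exists_hasTable_B.choose_spec.mapsCone (by simp)
theorem cfpC_0 : MapsCone cfpC [0] [1, 1] := exists_hasTable_C.choose_spec.mapsCone (by simp)
theorem cfpC_10 : MapsCone cfpC [1, 0] [0] := exists_hasTable_C.choose_spec.mapsCone (by simp)
theorem cfpC_11 : MapsCone cfpC [1, 1] [1, 0] := exists_hasTable_C.choose_spec.mapsCone (by simp)
theorem cfpP_0 : MapsCone cfpP [0] [1, 0] := exists_hasTable_P.choose_spec.mapsCone (by simp)
theorem cfpP_10 : MapsCone cfpP [1, 0] [0] := exists_hasTable_P.choose_spec.mapsCone (by simp)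
theorem cfpP_11 : MapsCone cfpP [1, 1] [1, 1] := exists_hasTable_P.choose_spec.mapsCone (by simp)

theorem stream_cases (x : Stream' (Fin 2)) : (∃ t, x = [0] ++ₛ t) ∨ ∃ t, x = [1] ++ₛ t := by
  rw [← append_stream_head_tail x]
  generalize x.head = a
  fin_cases a
  · exact Or.inl ⟨_, rfl⟩
  · exact Or.inr ⟨_, rfl⟩

theorem ext_smul_two {g h : ThompsonHigman 2} (e : ∀ x : Stream' (Fin 2), g • x = h • x) :
    g = h :=
  ext_smul (a := 0) (b := 1) (by decide) e

theorem MapsCone.unique {g : ThompsonHigman 2} {u v w : List (Fin 2)} (h1 : MapsCone g u v)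
    (h2 : MapsCone g u w) : v = w :=
  eq_of_forall_append_eq (a := (0 : Fin 2)) (b := 1) (by decide)
    fun t => (h1 t).symm.trans (h2 t)

/-- It suffices to compare two elements on words of length five. -/
theorem ext_cons {g h : ThompsonHigman 2}
    (e : ∀ (a b c d e : Fin 2) (t : Stream' (Fin 2)),
      g • ([a, b, c, d, e] ++ₛ t) = h • ([a, b, c, d, e] ++ₛ t)) : g = h := by
  refine ext_smul_two fun x => ?_
  have := e (x.get 0) (x.get 1) (x.get 2) (x.get 3) (x.get 4) (x.drop 5)
  rwa [show [x.get 0, x.get 1, x.get 2, x.get 3, x.get 4] = x.take 5 from rfl,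
    append_take_drop] at this

theorem cfpP_mul_self : cfpP * cfpP = 1 := by
  refine ext_cons fun a b c d e t => ?_
  have h0 := fun t => cfpP_0 t
  have h1 := fun t => cfpP_10 t
  have h2 := fun t => cfpP_11 t
  simp only [cons_append_stream, nil_append_stream] at h0 h1 h2 ⊢
  fin_cases a <;> fin_cases b <;> simp [mul_smul, h0, h1, h2]

theorem cfpC_pow_three : cfpC * cfpC * cfpC = 1 := by
  refine ext_cons fun a b c d e t => ?_
  have h0 := fun t => cfpC_0 t
  have h1 := fun t => cfpC_10 t
  have h2 := fun t => cfpC_11 t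
  simp only [cons_append_stream, nil_append_stream] at h0 h1 h2 ⊢
  fin_cases a <;> fin_cases b <;> simp [mul_smul, h0, h1, h2]

theorem cfpA_inv : cfpA⁻¹ = cfpC * cfpA * cfpC := by
  refine (eq_inv_of_mul_eq_one_left (ext_cons fun a b c d e t => ?_)).symm
  have h0 := fun t => cfpC_0 t
  have h1 := fun t => cfpC_10 t
  have h2 := fun t => cfpC_11 t
  have k0 := fun t => cfpA_0 t
  have k1 := fun t => cfpA_10 t
  have k2 := fun t => cfpA_11 t
  simp only [cons_append_stream, nil_append_stream] at h0 h1 h2 k0 k1 k2 ⊢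
  fin_cases a <;> fin_cases b <;> fin_cases c <;> simp [mul_smul, h0, h1, h2, k0, k1, k2]

theorem cfpB_inv : cfpB⁻¹ = cfpC * cfpA * cfpC * cfpC * cfpB * cfpC * cfpC := by
  refine (eq_inv_of_mul_eq_one_left (ext_cons fun a b c d e t => ?_)).symm
  have h0 := fun t => cfpC_0 t
  have h1 := fun t => cfpC_10 t
  have h2 := fun t => cfpC_11 t
  have k0 := fun t => cfpA_0 t
  have k1 := fun t => cfpA_10 t
  have k2 := fun t => cfpA_11 t
  have l0 := fun t => cfpB_0 t
  have l1 := fun t => cfpB_10 t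
  have l2 := fun t => cfpB_110 t
  have l3 := fun t => cfpB_111 t
  simp only [cons_append_stream, nil_append_stream] at h0 h1 h2 k0 k1 k2 l0 l1 l2 l3 ⊢
  fin_cases a <;> fin_cases b <;> fin_cases c <;> fin_cases d <;>
    simp [mul_smul, h0, h1, h2, k0, k1, k2, l0, l1, l2, l3]

/-- The Cannon–Floyd–Parry set generates a group as a monoid, by the relations `(CA)² = 1`,
`C³ = 1`, `π² = 1` and `B⁻¹ = A⁻¹ C B C⁻¹`. -/
theorem closure_cannonFloydParry_toSubmonoid :
    (Subgroup.closure cannonFloydParry).toSubmonoid = Submonoid.closure cannonFloydParry := by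
  rw [Subgroup.closure_toSubmonoid]
  refine le_antisymm (Submonoid.closure_le.2 (Set.union_subset Submonoid.subset_closure ?_))
    (Submonoid.closure_mono Set.subset_union_left)
  have hA : cfpA ∈ Submonoid.closure cannonFloydParry :=
    Submonoid.subset_closure (by simp [cannonFloydParry_eq])
  have hB : cfpB ∈ Submonoid.closure cannonFloydParry :=
    Submonoid.subset_closure (by simp [cannonFloydParry_eq])
  have hC : cfpC ∈ Submonoid.closure cannonFloydParry :=
    Submonoid.subset_closure (by simp [cannonFloydParry_eq])
  have hP : cfpP ∈ Submonoid.closure cannonFloydParry :=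
    Submonoid.subset_closure (by simp [cannonFloydParry_eq])
  intro g hg
  rw [Set.mem_inv, cannonFloydParry_eq] at hg
  simp only [Set.mem_insert_iff, Set.mem_singleton_iff, inv_eq_iff_eq_inv] at hg
  rcases hg with rfl | rfl | rfl | rfl
  · rw [cfpA_inv]
    exact mul_mem (mul_mem hC hA) hC
  · rw [cfpB_inv]
    exact mul_mem (mul_mem (mul_mem (mul_mem (mul_mem (mul_mem hC hA) hC) hC) hB) hC) hC
  · rw [← eq_inv_of_mul_eq_one_left cfpC_pow_three]
    exact mul_mem hC hC
  · rw [← eq_inv_of_mul_eq_one_left cfpP_mul_self]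
    exact hP

theorem cannonFloydParry_ncard : cannonFloydParry.Finite ∧ cannonFloydParry.ncard = 4 := by
  have key : ∀ {g h : ThompsonHigman 2} {u v : List (Fin 2)}, MapsCone g [0] u →
      MapsCone h [0] v → u ≠ v → g ≠ h := by
    rintro g h u v hu hv hne rfl
    exact hne (hu.unique hv)
  have h1 : cfpA ≠ cfpB := key cfpA_0 cfpB_0 (by decide)
  have h2 : cfpA ≠ cfpC := key cfpA_0 cfpC_0 (by decide)
  have h3 : cfpA ≠ cfpP := key cfpA_0 cfpP_0 (by decide)
  have h4 : cfpB ≠ cfpC := key cfpB_0 cfpC_0 (by decide)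
  have h5 : cfpB ≠ cfpP := key cfpB_0 cfpP_0 (by decide)
  have h6 : cfpC ≠ cfpP := key cfpC_0 cfpP_0 (by decide)
  rw [cannonFloydParry_eq]
  refine ⟨by simp, ?_⟩
  rw [Set.ncard_insert_of_notMem (by simp [h1, h2, h3]),
    Set.ncard_insert_of_notMem (by simp [h4, h5]), Set.ncard_pair h6]

theorem not_surjectivenessCondition_cannonFloydParry :
    ¬ SurjectivenessCondition cannonFloydParry := by
  refine not_surjectivenessCondition 1 ?_
  have key : ∀ {g : ThompsonHigman 2} {L : List (List (Fin 2) × List (Fin 2))},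
      g.HasTable L → (∀ p ∈ L, ¬ p.1 <+: [1]) → [1] ∉ Dom g := by
    rintro g L hg hL ⟨y, hy⟩
    obtain ⟨p, hp, w, e, -⟩ := (hg _ _).1 hy
    exact hL p hp ⟨w, e.symm⟩
  rintro γ (h | h | h | h)
  all_goals exact key h (by decide)

end ThompsonHigman

theorem Incomparable.notMem_cone {α : Type*} {u v : List α} (h : Incomparable u v)
    (t : Stream' α) : u ++ₛ t ∉ cone v :=
  fun hv => Set.disjoint_left.1 h.disjoint (append_mem_cone u t) hv

theorem Incomparable.concat {α : Type*} {a b : α} (hab : a ≠ b) (u : List α) :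
    Incomparable (u ++ [a]) (u ++ [b]) :=
  Incomparable.append_left (u := [a]) (v := [b])
    (.of_length_eq rfl fun h => hab (List.singleton_injective h)) u

namespace ThompsonHigman

theorem mem_cone_iff_child {u : List (Fin 2)} {x : Stream' (Fin 2)} :
    x ∈ cone u ↔ x ∈ cone (u ++ [0]) ∨ x ∈ cone (u ++ [1]) := by
  constructor
  · rintro ⟨t, rfl⟩
    rcases stream_cases t with ⟨t, rfl⟩ | ⟨t, rfl⟩
    · exact Or.inl ⟨t, (append_append_stream _ _ _).symm⟩
    · exact Or.inr ⟨t, (append_append_stream _ _ _).symm⟩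
  · rintro (h | h)
    · exact cone_anti (List.prefix_append _ _) h
    · exact cone_anti (List.prefix_append _ _) h

theorem MapsCone.of_children {g : ThompsonHigman 2} {u v : List (Fin 2)}
    (h0 : MapsCone g (u ++ [0]) (v ++ [0])) (h1 : MapsCone g (u ++ [1]) (v ++ [1])) :
    MapsCone g u v := by
  intro t
  rcases stream_cases t with ⟨t, rfl⟩ | ⟨t, rfl⟩
  · rw [← append_append_stream, h0, append_append_stream]
  · rw [← append_append_stream, h1, append_append_stream]

/-! ### Interchanging two cones -/

/-- `s` interchanges the cones of `u` and `v` by `u t ↔ v t` and fixes all other infinite words. -/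
structure IsConeSwap (s : ThompsonHigman 2) (u v : List (Fin 2)) : Prop where
  left : MapsCone s u v
  right : MapsCone s v u
  fix : ∀ x, x ∉ cone u → x ∉ cone v → s • x = x

namespace IsConeSwap

variable {s s' h : ThompsonHigman 2} {u v u' v' : List (Fin 2)}

theorem unique (hs : IsConeSwap s u v) (hs' : IsConeSwap s' u v) : s = s' := by
  refine ext_smul_two fun x => ?_
  by_cases h1 : x ∈ cone u
  · obtain ⟨t, rfl⟩ := h1
    rw [hs.left, hs'.left]
  · by_cases h2 : x ∈ cone v
    · obtain ⟨t, rfl⟩ := h2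
      rw [hs.right, hs'.right]
    · rw [hs.fix x h1 h2, hs'.fix x h1 h2]

theorem conj (hs : IsConeSwap s u v) (hu : MapsCone h u u') (hv : MapsCone h v v') :
    IsConeSwap (h * s * h⁻¹) u' v' where
  left := (hv.mul hs.left).mul hu.inv
  right := (hu.mul hs.right).mul hv.inv
  fix x h1 h2 := by
    rw [mul_smul, mul_smul, hs.fix, smul_inv_smul]
    · rwa [hu.inv.smul_mem_iff]
    · rwa [hv.inv.smul_mem_iff]

theorem mapsCone_self {w : List (Fin 2)} (hs : IsConeSwap s u v) (hu : Incomparable w u)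
    (hv : Incomparable w v) : MapsCone s w w :=
  fun t => hs.fix _ (hu.notMem_cone t) (hv.notMem_cone t)

/-- Interchanging two cones amounts to interchanging their halves. -/
theorem mul_children (huv : Incomparable u v) (h0 : IsConeSwap s (u ++ [0]) (v ++ [0]))
    (h1 : IsConeSwap s' (u ++ [1]) (v ++ [1])) : IsConeSwap (s * s') u v := by
  have i1 : ∀ u : List (Fin 2), Incomparable (u ++ [0]) (u ++ [1]) :=
    Incomparable.concat (by decide)
  have i2 := huv.append [0] [1]
  have i3 := huv.append [1] [0]
  refine ⟨.of_children ?_ ?_, .of_children ?_ ?_, fun x hu hv => ?_⟩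
  · exact h0.left.mul (h1.mapsCone_self (i1 u) i2)
  · exact (h0.mapsCone_self i2.symm (i1 v).symm).mul h1.left
  · exact h0.right.mul (h1.mapsCone_self i3.symm (i1 v))
  · exact (h0.mapsCone_self (i1 u).symm i3).mul h1.right
  · rw [mem_cone_iff_child, not_or] at hu hv
    rw [mul_smul, h1.fix x hu.2 hv.2, h0.fix x hu.1 hv.1]

end IsConeSwap

theorem exists_isConeSwap_of_forall_append {K : Subgroup (ThompsonHigman 2)} (N : ℕ) :
    ∀ {u v : List (Fin 2)}, Incomparable u v →
      (∀ w : List (Fin 2), w.length = N → ∃ s ∈ K, IsConeSwap s (u ++ w) (v ++ w)) →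
      ∃ s ∈ K, IsConeSwap s u v := by
  induction N with
  | zero =>
    intro u v _ h
    simpa using h [] rfl
  | succ N ih =>
    intro u v huv h
    have step : ∀ b : Fin 2, ∃ s ∈ K, IsConeSwap s (u ++ [b]) (v ++ [b]) := fun b =>
      ih (huv.append [b] [b]) fun w hw => by
        simpa using h (b :: w) (by simp [hw])
    obtain ⟨s, hs, h0⟩ := step 0
    obtain ⟨s', hs', h1⟩ := step 1
    exact ⟨s * s', mul_mem hs hs', .mul_children huv h0 h1⟩

theorem isConeSwap_cfpP : IsConeSwap cfpP [0] [1, 0] where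
  left := cfpP_0
  right := cfpP_10
  fix x h0 h1 := by
    have h : x ∈ cone [1, 1] := by
      rcases stream_cases x with ⟨x, rfl⟩ | ⟨x, rfl⟩
      · exact absurd (append_mem_cone _ _) h0
      · rcases mem_cone_iff_child.1 (append_mem_cone [1] x) with h | h
        · exact absurd h h1
        · exact h
    obtain ⟨t, rfl⟩ := h
    exact cfpP_11 t

/-! ### Transitivity of the group generated by the Cannon–Floyd–Parry set -/

/-- The group generated by the Cannon–Floyd–Parry set. -/
noncomputable def cfpGroup : Subgroup (ThompsonHigman 2) := Subgroup.closure cannonFloydParry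

theorem cfpA_mem : cfpA ∈ cfpGroup := Subgroup.subset_closure (by simp [cannonFloydParry_eq])
theorem cfpB_mem : cfpB ∈ cfpGroup := Subgroup.subset_closure (by simp [cannonFloydParry_eq])
theorem cfpC_mem : cfpC ∈ cfpGroup := Subgroup.subset_closure (by simp [cannonFloydParry_eq])
theorem cfpP_mem : cfpP ∈ cfpGroup := Subgroup.subset_closure (by simp [cannonFloydParry_eq])

/-- `A⁻¹` and `C` shorten every word of length at least two. -/
theorem exists_mapsCone_zero (a : Fin 2) (w : List (Fin 2)) :
    ∃ h ∈ cfpGroup, MapsCone h (a :: w) [0] := by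
  have hA := cfpA_mem
  have hC := cfpC_mem
  induction w generalizing a with
  | nil =>
    fin_cases a
    · exact ⟨1, one_mem _, .one _⟩
    · exact ⟨cfpC * cfpC * cfpA⁻¹, mul_mem (mul_mem hC hC) (inv_mem hA),
        (cfpC_10.mul cfpC_11).mul cfpA_11.inv⟩
  | cons b w ih =>
    obtain ⟨g, hg, hgm⟩ : ∃ g ∈ cfpGroup, MapsCone g [a, b] [0] := by
      fin_cases a <;> fin_cases b
      · exact ⟨cfpA⁻¹, inv_mem hA, cfpA_0.inv⟩
      · exact ⟨cfpC * cfpA⁻¹, mul_mem hC (inv_mem hA), cfpC_10.mul cfpA_10.inv⟩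
      · exact ⟨cfpC, hC, cfpC_10⟩
      · exact ⟨cfpC * cfpC, mul_mem hC hC, cfpC_10.mul cfpC_11⟩
    obtain ⟨h, hh, hhm⟩ := ih 0
    exact ⟨h * g, mul_mem hh hg, hhm.mul (hgm.append w)⟩

/-- `B` and `C π` fix the cone of `0`. On the cone of `1`, the first acts like `A` and the second
interchanges the two halves. -/
theorem exists_mapsCone_fix_zero (a : Fin 2) (w : List (Fin 2)) :
    ∃ h ∈ cfpGroup, MapsCone h [0] [0] ∧ MapsCone h (1 :: a :: w) [1, 0] := by
  have hB := inv_mem cfpB_mem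
  have hS := mul_mem cfpC_mem cfpP_mem
  have b0 := cfpB_0.inv
  have b1 := cfpB_10.inv
  have b2 := cfpB_110.inv
  have s0 : MapsCone (cfpC * cfpP) [0] [0] := cfpC_10.mul cfpP_0
  have s1 : MapsCone (cfpC * cfpP) [1, 0] [1, 1] := cfpC_0.mul cfpP_10
  have s2 : MapsCone (cfpC * cfpP) [1, 1] [1, 0] := cfpC_11.mul cfpP_11
  induction w generalizing a with
  | nil =>
    fin_cases a
    · exact ⟨1, one_mem _, .one _, .one _⟩
    · exact ⟨cfpC * cfpP, hS, s0, s2⟩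
  | cons b w ih =>
    obtain ⟨g, hg, hg0, hgm⟩ : ∃ g ∈ cfpGroup, MapsCone g [0] [0] ∧
        MapsCone g [1, a, b] [1, 0] := by
      fin_cases a <;> fin_cases b
      · exact ⟨cfpB⁻¹, hB, b0, b1⟩
      · exact ⟨cfpB⁻¹ * (cfpC * cfpP) * cfpB⁻¹, mul_mem (mul_mem hB hS) hB,
          (b0.mul s0).mul b0, (b1.mul (s2.append [0])).mul b2⟩
      · exact ⟨cfpB⁻¹ * (cfpC * cfpP), mul_mem hB hS, b0.mul s0, b1.mul (s2.append [0])⟩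
      · exact ⟨cfpB⁻¹ * (cfpC * cfpP) * cfpB⁻¹ * (cfpC * cfpP),
          mul_mem (mul_mem (mul_mem hB hS) hB) hS, ((b0.mul s0).mul b0).mul s0,
          ((b1.mul (s2.append [0])).mul b2).mul (s2.append [1])⟩
    obtain ⟨h, hh, hh0, hhm⟩ := ih 0
    exact ⟨h * g, mul_mem hh hg, hh0.mul hg0, hhm.mul (hgm.append w)⟩

/-- After a subdivision, any two disjoint cones are moved to those of `0` and `10`. -/
theorem exists_mapsCone_pair {u v : List (Fin 2)} (huv : Incomparable u v) :
    ∃ N : ℕ, ∀ w : List (Fin 2), w.length = N →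
      ∃ h ∈ cfpGroup, MapsCone h [0] (u ++ w) ∧ MapsCone h [1, 0] (v ++ w) := by
  obtain ⟨h1, hh1, hu⟩ : ∃ h ∈ cfpGroup, MapsCone h u [0] := by
    cases u with
    | nil => exact absurd (List.nil_prefix) huv.1
    | cons a u => exact exists_mapsCone_zero a u
  obtain ⟨N, hN⟩ := exists_mapsCone h1
  refine ⟨N + 1, fun w hw => ?_⟩
  obtain ⟨w, b, rfl⟩ : ∃ w' b, w = w' ++ [b] :=
    ⟨w.dropLast, w.getLast (by rintro rfl; simp at hw),
      (List.dropLast_append_getLast _).symm⟩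
  simp only [List.length_append, List.length_singleton, Nat.add_right_cancel_iff] at hw
  obtain ⟨v', hv'⟩ := hN (v ++ w) (by simp [hw])
  have hinc : Incomparable [0] v' :=
    hu.incomparable hv' (by simpa using huv.append [] w)
  -- the last letter of the subdivision makes the image of `v w` at least two letters long
  obtain ⟨c, r, hcr⟩ : ∃ (c : Fin 2) (r : List (Fin 2)), v' ++ [b] = 1 :: c :: r := by
    rcases v' with _ | ⟨a, v'⟩
    · exact absurd List.nil_prefix hinc.2
    · have ha : a = 1 := by
        fin_cases a
        · exact absurd (by simp) hinc.1
        · rfl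
      subst ha
      rcases v' with _ | ⟨c, v'⟩
      · exact ⟨b, [], rfl⟩
      · exact ⟨c, v' ++ [b], rfl⟩
  obtain ⟨h2, hh2, h20, h21⟩ := exists_mapsCone_fix_zero c r
  rw [← hcr] at h21
  have e1 : MapsCone (h2 * h1) (u ++ (w ++ [b])) (0 :: (w ++ [b])) :=
    (h20.mul hu).append (w ++ [b])
  have e2 : MapsCone (h2 * h1) (v ++ (w ++ [b])) [1, 0] := by
    have := h21.mul (hv'.append [b])
    rwa [List.append_assoc] at this
  obtain ⟨h3, hh3, h30, h31⟩ : ∃ h ∈ cfpGroup, MapsCone h [0] [0] ∧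
      MapsCone h (1 :: 0 :: (w ++ [b])) [1, 0] := exists_mapsCone_fix_zero _ _
  have f1 : MapsCone (cfpP * (h3 * (cfpP * (h2 * h1)))) (u ++ (w ++ [b])) [0] :=
    cfpP_10.mul (h31.mul ((cfpP_0.append (w ++ [b])).mul e1))
  have f2 : MapsCone (cfpP * (h3 * (cfpP * (h2 * h1)))) (v ++ (w ++ [b])) [1, 0] :=
    cfpP_0.mul (h30.mul (cfpP_10.mul e2))
  exact ⟨_, inv_mem (mul_mem cfpP_mem (mul_mem hh3 (mul_mem cfpP_mem (mul_mem hh2 hh1)))),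
    f1.inv, f2.inv⟩

theorem exists_isConeSwap_mem {K : Subgroup (ThompsonHigman 2)} (hP : cfpP ∈ K)
    (hK : ∀ h ∈ cfpGroup, ∀ g ∈ K, h * g * h⁻¹ ∈ K) {u v : List (Fin 2)}
    (huv : Incomparable u v) : ∃ s ∈ K, IsConeSwap s u v := by
  obtain ⟨N, hN⟩ := exists_mapsCone_pair huv
  refine exists_isConeSwap_of_forall_append N huv fun w hw => ?_
  obtain ⟨h, hh, h0, h1⟩ := hN w hw
  exact ⟨h * cfpP * h⁻¹, hK h hh _ hP, isConeSwap_cfpP.conj h0 h1⟩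

theorem exists_isConeSwap {u v : List (Fin 2)} (huv : Incomparable u v) :
    ∃ s, IsConeSwap s u v := by
  obtain ⟨s, -, hs⟩ := exists_isConeSwap_mem (K := ⊤) trivial (by simp) huv
  exact ⟨s, hs⟩

/-! ### Cone interchanges generate `G_{2,1}` -/

/-- A complete prefix code: every infinite word has exactly one prefix in `C`. -/
def IsCode (C : Finset (List (Fin 2))) : Prop :=
  ∀ x : Stream' (Fin 2), ∃ c ∈ C, x ∈ cone c ∧ ∀ d ∈ C, x ∈ cone d → d = c

namespace IsCode

variable {C : Finset (List (Fin 2))}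

theorem eq_of_mem_cone (hC : IsCode C) {c d : List (Fin 2)} (hc : c ∈ C) (hd : d ∈ C)
    {x : Stream' (Fin 2)} (h1 : x ∈ cone c) (h2 : x ∈ cone d) : c = d := by
  obtain ⟨e, -, -, he⟩ := hC x
  exact (he c hc h1).trans (he d hd h2).symm

theorem incomparable (hC : IsCode C) {c d : List (Fin 2)} (hc : c ∈ C) (hd : d ∈ C)
    (hne : c ≠ d) : Incomparable c d :=
  .of_disjoint (Set.disjoint_left.2 fun _ h1 h2 => hne (hC.eq_of_mem_cone hc hd h1 h2))

/-- A longest word of a nontrivial code belongs to a pair of siblings in the code. -/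
theorem exists_caret (hC : IsCode C) (h : [] ∉ C) : ∃ p, ∀ b : Fin 2, p ++ [b] ∈ C := by
  have hne : C.Nonempty := (hC (const 0)).imp fun _ h => h.1
  obtain ⟨c, hc, hmax⟩ := C.exists_max_image List.length hne
  have hcne : c ≠ [] := fun e => h (e ▸ hc)
  obtain ⟨p, a, rfl⟩ : ∃ p a, c = p ++ [a] :=
    ⟨c.dropLast, c.getLast hcne, (List.dropLast_append_getLast _).symm⟩
  refine ⟨p, fun b => ?_⟩
  obtain ⟨e, he, hxe, -⟩ := hC ((p ++ [b]) ++ₛ const 0)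
  have hlen := hmax e he
  have hpre : e <+: p ++ [b] :=
    prefix_of_mem_cone hxe (append_mem_cone _ _) (by simpa using hlen)
  rcases List.prefix_concat_iff.1 hpre with rfl | hep
  · exact he
  · have : e = p ++ [a] := hC.eq_of_mem_cone he hc
      (cone_anti (hep.trans (List.prefix_append p [a])) (append_mem_cone _ (const 0)))
      (append_mem_cone _ _)
    have := hep.length_le
    simp_all

theorem image (hC : IsCode C) {g : ThompsonHigman 2} {f : List (Fin 2) → List (Fin 2)}
    (hf : ∀ c ∈ C, MapsCone g c (f c)) : IsCode (C.image f) := by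
  intro x
  obtain ⟨c, hc, hxc, huniq⟩ := hC (g⁻¹ • x)
  refine ⟨f c, Finset.mem_image_of_mem f hc, by simpa using (hf c hc).smul_mem hxc, ?_⟩
  intro d hd hxd
  obtain ⟨c', hc', rfl⟩ := Finset.mem_image.1 hd
  rw [huniq c' hc' ((hf c' hc').inv.smul_mem hxd)]

theorem contract (hC : IsCode C) {p : List (Fin 2)} (h0 : p ++ [0] ∈ C) (h1 : p ++ [1] ∈ C) :
    IsCode (insert p ((C.erase (p ++ [0])).erase (p ++ [1]))) := by
  intro x
  by_cases hx : x ∈ cone p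
  · refine ⟨p, Finset.mem_insert_self _ _, hx, fun d hd hxd => ?_⟩
    simp only [Finset.mem_insert, Finset.mem_erase] at hd
    rcases hd with rfl | ⟨hd1, hd0, hd⟩
    · rfl
    · rcases mem_cone_iff_child.1 hx with hx | hx
      · exact absurd (hC.eq_of_mem_cone hd h0 hxd hx) hd0
      · exact absurd (hC.eq_of_mem_cone hd h1 hxd hx) hd1
  · obtain ⟨c, hc, hxc, huniq⟩ := hC x
    have hne : ∀ b : Fin 2, c ≠ p ++ [b] := by
      rintro b rfl
      exact hx (cone_anti (List.prefix_append _ _) hxc)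
    refine ⟨c, by simp [hne, hc], hxc, fun d hd hxd => ?_⟩
    simp only [Finset.mem_insert, Finset.mem_erase] at hd
    rcases hd with rfl | ⟨-, -, hd⟩
    · exact absurd hxd hx
    · exact huniq d hd hxd

theorem card_contract {p : List (Fin 2)} (h0 : p ++ [0] ∈ C)
    (h1 : p ++ [1] ∈ C) :
    (insert p ((C.erase (p ++ [0])).erase (p ++ [1]))).card < C.card := by
  have hne : p ++ [1] ≠ p ++ [0] := by simp
  have e1 := Finset.card_erase_add_one h0
  have e2 := Finset.card_erase_add_one (Finset.mem_erase.2 ⟨hne, h1⟩)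
  have e3 := Finset.card_insert_le p ((C.erase (p ++ [0])).erase (p ++ [1]))
  omega

/-- The words of a code can be permuted arbitrarily by cone interchanges. -/
theorem exists_swap (hC : IsCode C) {K : Subgroup (ThompsonHigman 2)}
    (hK : ∀ u v : List (Fin 2), Incomparable u v → ∃ s ∈ K, IsConeSwap s u v)
    {c d : List (Fin 2)} (hc : c ∈ C) (hd : d ∈ C) :
    ∃ s ∈ K, MapsCone s c d ∧ MapsCone s d c ∧ ∀ e ∈ C, e ≠ c → e ≠ d → MapsCone s e e := by
  by_cases hcd : c = d
  · subst hcd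
    exact ⟨1, one_mem _, .one _, .one _, fun e _ _ _ => .one _⟩
  · obtain ⟨s, hs, hsw⟩ := hK c d (hC.incomparable hc hd hcd)
    exact ⟨s, hs, hsw.left, hsw.right, fun e he h1 h2 =>
      hsw.mapsCone_self (hC.incomparable he hc h1) (hC.incomparable he hd h2)⟩

end IsCode

theorem eq_one_of_mapsCone_nil {g : ThompsonHigman 2} {d : List (Fin 2)}
    (h : MapsCone g [] d) : g = 1 := by
  cases d with
  | nil => exact ext_smul_two fun x => by simpa using h x
  | cons a d =>
    exfalso
    obtain ⟨b, hb⟩ := exists_ne a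
    have h1 := h (g⁻¹ • ([b] ++ₛ const 0))
    rw [nil_append_stream, smul_inv_smul] at h1
    exact hb (congrArg head h1)

/-- If `g` maps the cones of a complete prefix code to cones, then interchanging image cones makes
`g` map a pair of siblings to a pair of siblings, and the code can be replaced by a smaller one. -/
theorem mem_of_isCode {K : Subgroup (ThompsonHigman 2)}
    (hK : ∀ u v : List (Fin 2), Incomparable u v → ∃ s ∈ K, IsConeSwap s u v) (n : ℕ) :
    ∀ C : Finset (List (Fin 2)), C.card = n → IsCode C → ∀ g : ThompsonHigman 2,
      (∀ c ∈ C, ∃ d, MapsCone g c d) → g ∈ K := by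
  induction n using Nat.strong_induction_on with
  | _ n ih =>
    rintro C rfl hC g hg
    by_cases hnil : [] ∈ C
    · obtain ⟨d, hd⟩ := hg [] hnil
      exact eq_one_of_mapsCone_nil hd ▸ one_mem K
    choose! f hf using hg
    obtain ⟨p, hp⟩ := hC.exists_caret hnil
    have hD := hC.image hf
    have hfm : ∀ c ∈ C, f c ∈ C.image f := fun c hc => Finset.mem_image_of_mem f hc
    have hinj : ∀ c ∈ C, ∀ d ∈ C, f c = f d → c = d := by
      intro c hc d hd e
      by_contra hne
      have := (hf c hc).incomparable (hf d hd) (hC.incomparable hc hd hne)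
      rw [e] at this
      exact this.1 (List.prefix_refl _)
    have hDnil : [] ∉ C.image f := by
      intro h
      have h0 := hD.eq_of_mem_cone h (hfm _ (hp 0)) ⟨_, (nil_append_stream _).symm⟩
        (append_mem_cone _ (const 0))
      have h1 := hD.eq_of_mem_cone h (hfm _ (hp 1)) ⟨_, (nil_append_stream _).symm⟩
        (append_mem_cone _ (const 0))
      have := hinj _ (hp 0) _ (hp 1) (h0.symm.trans h1)
      simp at this
    obtain ⟨q, hq⟩ := hD.exists_caret hDnil
    -- `s₁` moves the image of `p 0` to `q 0`
    obtain ⟨s₁, hs₁, m1, m1', m1f⟩ := hD.exists_swap hK (hfm _ (hp 0)) (hq 0)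
    have hs₁D : ∀ d ∈ C.image f, ∃ d' ∈ C.image f, MapsCone s₁ d d' := by
      intro d hd
      by_cases e1 : d = f (p ++ [0])
      · exact ⟨_, hq 0, e1 ▸ m1⟩
      by_cases e2 : d = q ++ [0]
      · exact ⟨_, hfm _ (hp 0), e2 ▸ m1'⟩
      exact ⟨d, hd, m1f d hd e1 e2⟩
    -- `s₂` moves the image of `p 1` to `q 1` and fixes the cone of `q 0`
    obtain ⟨e, heD, he⟩ := hs₁D _ (hfm _ (hp 1))
    have hne : q ++ [0] ≠ e := by
      rintro rfl
      have h1 := m1.inv.unique he.inv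
      have := hinj _ (hp 0) _ (hp 1) h1
      simp at this
    obtain ⟨s₂, hs₂, m2, m2', m2f⟩ := hD.exists_swap hK heD (hq 1)
    have hs₂D : ∀ d ∈ C.image f, ∃ d', MapsCone s₂ d d' := by
      intro d hd
      by_cases e1 : d = e
      · exact ⟨_, e1 ▸ m2⟩
      by_cases e2 : d = q ++ [1]
      · exact ⟨_, e2 ▸ m2'⟩
      exact ⟨d, m2f d hd e1 e2⟩
    have hmem : s₂ * (s₁ * g) ∈ K := by
      refine ih _ (IsCode.card_contract (hp 0) (hp 1)) _ rfl (hC.contract (hp 0) (hp 1)) _ ?_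
      intro c hc
      simp only [Finset.mem_insert, Finset.mem_erase] at hc
      rcases hc with rfl | ⟨-, -, hc⟩
      · refine ⟨q, .of_children ?_ ?_⟩
        · exact (m2f _ (hq 0) hne (by simp)).mul (m1.mul (hf _ (hp 0)))
        · exact m2.mul (he.mul (hf _ (hp 1)))
      · obtain ⟨d, hd, hd'⟩ := hs₁D _ (hfm c hc)
        obtain ⟨d', hd''⟩ := hs₂D d hd
        exact ⟨d', hd''.mul (hd'.mul (hf c hc))⟩
    rwa [K.mul_mem_cancel_left hs₂, K.mul_mem_cancel_left hs₁] at hmem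

theorem eq_top_of_forall_isConeSwap {K : Subgroup (ThompsonHigman 2)}
    (hK : ∀ u v : List (Fin 2), Incomparable u v → ∃ s ∈ K, IsConeSwap s u v) : K = ⊤ := by
  rw [eq_top_iff]
  intro g _
  obtain ⟨N, hN⟩ := exists_mapsCone g
  have hfin : {u : List (Fin 2) | u.length = N}.Finite := List.finite_length_eq (Fin 2) N
  refine mem_of_isCode hK _ hfin.toFinset rfl (fun x => ⟨x.take N, by simp, mem_cone_take x N, ?_⟩)
    g fun c hc => hN c ?_
  · intro d hd hxd
    have hd' : d.length = N := by simpa using hd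
    rw [← mem_cone_iff_take.1 hxd, hd']
  · have hc' : c.length = N := by simpa using hc
    exact hc'.ge

theorem cfpGroup_eq_top : cfpGroup = ⊤ :=
  eq_top_of_forall_isConeSwap fun _ _ huv =>
    exists_isConeSwap_mem cfpP_mem (fun _ hh _ hg => mul_mem (mul_mem hh hg) (inv_mem hh)) huv

theorem closure_cannonFloydParry : Submonoid.closure cannonFloydParry = ⊤ := by
  rw [← closure_cannonFloydParry_toSubmonoid]
  change cfpGroup.toSubmonoid = ⊤
  rw [cfpGroup_eq_top]
  rfl

end ThompsonHigman

open scoped commutatorElement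

namespace ThompsonHigman

/-! ### Supports and displaced sets -/

/-- `g` fixes every infinite word that is not in `S`. -/
def FixesOutside (g : ThompsonHigman 2) (S : Set (Stream' (Fin 2))) : Prop :=
  ∀ x, x ∉ S → g • x = x

namespace FixesOutside

variable {g h : ThompsonHigman 2} {S T : Set (Stream' (Fin 2))}

theorem mul (hg : FixesOutside g S) (hh : FixesOutside h S) : FixesOutside (g * h) S :=
  fun x hx => by rw [mul_smul, hh x hx, hg x hx]

theorem inv (hg : FixesOutside g S) : FixesOutside g⁻¹ S :=
  fun x hx => inv_smul_eq_iff.2 (hg x hx).symm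

theorem commutator (hg : FixesOutside g S) (hh : FixesOutside h S) : FixesOutside ⁅g, h⁆ S :=
  ((hg.mul hh).mul hg.inv).mul hh.inv

theorem conj (hg : FixesOutside g S) (h : ThompsonHigman 2) :
    FixesOutside (h * g * h⁻¹) {x | h⁻¹ • x ∈ S} :=
  fun x hx => by rw [mul_smul, mul_smul, hg _ hx, smul_inv_smul]

theorem mono (hg : FixesOutside g S) (hST : S ⊆ T) : FixesOutside g T :=
  fun x hx => hg x fun h => hx (hST h)

theorem eq_one (hg : FixesOutside g S) (hg' : FixesOutside g T) (hST : Disjoint S T) : g = 1 := by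
  refine ext_smul_two fun x => ?_
  rw [one_smul]
  by_cases hx : x ∈ S
  · exact hg' x (Set.disjoint_left.1 hST hx)
  · exact hg x hx

theorem smul_mem (hg : FixesOutside g S) {x : Stream' (Fin 2)} (hx : x ∈ S) : g • x ∈ S := by
  by_contra h
  have := hg _ h
  rw [smul_left_cancel_iff] at this
  exact h (by rwa [this])

theorem commute (hg : FixesOutside g S) (hh : FixesOutside h T) (hST : Disjoint S T) :
    Commute g h := by
  refine ext_smul_two fun x => ?_
  rw [mul_smul, mul_smul]
  by_cases hS : x ∈ S
  · rw [hh x (Set.disjoint_left.1 hST hS), hh _ (Set.disjoint_left.1 hST (hg.smul_mem hS))]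
  · rw [hg x hS]
    by_cases hT : x ∈ T
    · exact hg _ (Set.disjoint_right.1 hST (hh.smul_mem hT))
    · rw [hh x hT, hg x hS]

/-- If `g` moves `S` off itself, then `⁅s, g⁆` acts on `S` like `s`, so that the commutators of
`s` and `⁅s, g⁆` with elements supported in `S` agree. -/
theorem commutator_commutator {s t : ThompsonHigman 2} (hs : FixesOutside s S)
    (ht : FixesOutside t S) (hg : ∀ x ∈ S, g • x ∉ S) : ⁅⁅s, g⁆, t⁆ = ⁅s, t⁆ := by
  have hr : Commute (g * s⁻¹ * g⁻¹) t := by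
    refine (hs.inv.conj g).commute ht (Set.disjoint_left.2 fun x h1 h2 => ?_)
    have := hg _ h1
    rw [smul_inv_smul] at this
    exact this h2
  have e : ⁅s, g⁆ = s * (g * s⁻¹ * g⁻¹) := by simp only [commutatorElement_def, mul_assoc]
  rw [e]
  generalize g * s⁻¹ * g⁻¹ = r at hr
  rw [commutatorElement_def, commutatorElement_def, mul_inv_rev, mul_assoc s r t, hr.eq]
  group

end FixesOutside

theorem IsConeSwap.fixesOutside {s : ThompsonHigman 2} {u v w : List (Fin 2)}
    (hs : IsConeSwap s u v) (hu : w <+: u) (hv : w <+: v) : FixesOutside s (cone w) :=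
  fun x hx => hs.fix x (fun h => hx (cone_anti hu h)) fun h => hx (cone_anti hv h)

theorem IsConeSwap.inv {s : ThompsonHigman 2} {u v : List (Fin 2)} (hs : IsConeSwap s u v) :
    IsConeSwap s⁻¹ u v :=
  ⟨hs.right.inv, hs.left.inv, fun x hu hv => inv_smul_eq_iff.2 (hs.fix x hu hv).symm⟩

/-! ### Simplicity of `G_{2,1}` -/

/-- An element that moves `x` moves a small cone around `x` off itself. -/
theorem exists_incomparable_mapsCone {g : ThompsonHigman 2} (hg : g ≠ 1) :
    ∃ u v, Incomparable u v ∧ MapsCone g u v := by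
  obtain ⟨x, hx⟩ : ∃ x : Stream' (Fin 2), x ≠ g • x := by
    by_contra! h
    exact hg (ext_smul_two fun x => by rw [one_smul, ← h x])
  obtain ⟨n, hn⟩ := exists_take_ne hx
  obtain ⟨N, hN⟩ := exists_mapsCone g
  obtain ⟨v, hv⟩ := hN (x.take N) (by simp)
  have hm := hv.append ((x.drop N).take n)
  have hxu : x ∈ cone (x.take N ++ (x.drop N).take n) := by
    rw [← take_add]
    exact mem_cone_take x _
  refine ⟨_, _, .of_disjoint (Set.disjoint_left.2 fun y h1 h2 => hn ?_), hm⟩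
  exact (take_eq_take_of_mem_cone (by simp) hxu h1).trans
    (take_eq_take_of_mem_cone (by simp) h2 (hm.smul_mem hxu))

/-- An interchange of two cones is a commutator of permutations of their halves. -/
theorem exists_commutator_isConeSwap {u v w : List (Fin 2)} (huv : Incomparable u v)
    (hu : w <+: u) (hv : w <+: v) : ∃ s t, FixesOutside s (cone w) ∧ FixesOutside t (cone w) ∧
      IsConeSwap ⁅s, t⁆ u v := by
  have i1 : ∀ u : List (Fin 2), Incomparable (u ++ [0]) (u ++ [1]) :=
    Incomparable.concat (by decide)
  have hu' : ∀ a, w <+: u ++ [a] := fun a => hu.trans (List.prefix_append _ _)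
  have hv' : ∀ a, w <+: v ++ [a] := fun a => hv.trans (List.prefix_append _ _)
  obtain ⟨s, hs⟩ := exists_isConeSwap (huv.append [0] [0])
  obtain ⟨t₁, ht₁⟩ := exists_isConeSwap (i1 u)
  obtain ⟨t₂, ht₂⟩ := exists_isConeSwap (i1 v)
  refine ⟨s, t₁ * t₂, hs.fixesOutside (hu' 0) (hv' 0),
    (ht₁.fixesOutside (hu' 0) (hu' 1)).mul (ht₂.fixesOutside (hv' 0) (hv' 1)), ?_⟩
  have e : ⁅s, t₁ * t₂⁆ = s * (t₁ * t₂ * s⁻¹ * (t₁ * t₂)⁻¹) := by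
    simp only [commutatorElement_def, mul_assoc]
  rw [e]
  refine .mul_children huv hs (hs.inv.conj ?_ ?_)
  · exact ht₁.left.mul (ht₂.mapsCone_self (huv.append _ _) (huv.append _ _))
  · exact (ht₁.mapsCone_self (huv.symm.append _ _) (huv.symm.append _ _)).mul ht₂.left

/-- The group `G_{2,1}` is simple: if `g ∈ K` moves a cone off itself, `K` contains the commutators
of elements supported in this cone, hence a conjugate of `π₀`, and all cone interchanges. -/
theorem eq_top_of_normal {K : Subgroup (ThompsonHigman 2)} [hK : K.Normal] (h : K ≠ ⊥) :
    K = ⊤ := by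
  obtain ⟨g, hg, hg1⟩ := K.bot_or_exists_ne_one.resolve_left h
  obtain ⟨u, v, huv, hm⟩ := exists_incomparable_mapsCone hg1
  have hinc : Incomparable (u ++ [0]) (u ++ [1]) := .concat (by decide) u
  obtain ⟨N, hN⟩ := exists_mapsCone_pair hinc
  obtain ⟨h, -, h0, h1⟩ := hN (List.replicate N 0) (by simp)
  obtain ⟨s, t, hs, ht, hst⟩ := exists_commutator_isConeSwap (w := u)
    (hinc.append (List.replicate N 0) (List.replicate N 0)) (by simp) (by simp)
  have hmem : ⁅s, t⁆ ∈ K := by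
    rw [← hs.commutator_commutator ht (g := g) fun x hx =>
      Set.disjoint_right.1 huv.disjoint (hm.smul_mem hx)]
    have hsg : ⁅s, g⁆ ∈ K := mul_mem (hK.conj_mem g hg s) (inv_mem hg)
    have e : ⁅⁅s, g⁆, t⁆ = ⁅s, g⁆ * (t * ⁅s, g⁆⁻¹ * t⁻¹) := by
      rw [commutatorElement_def ⁅s, g⁆]
      simp only [mul_assoc]
    rw [e]
    exact mul_mem hsg (hK.conj_mem _ (inv_mem hsg) t)
  have hP : cfpP ∈ K := by
    have := hst.conj h0.inv h1.inv
    rw [isConeSwap_cfpP.unique this]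
    exact hK.conj_mem _ hmem _
  exact eq_top_of_forall_isConeSwap fun _ _ huv =>
    exists_isConeSwap_mem hP (fun h _ g hg => hK.conj_mem g hg h) huv

/-! ### Centralizers of involutions -/

section Flip

variable {τ : ThompsonHigman 2}

/-- The infinite words whose tail has the prefix `u`: the union of the cones of `0 u` and `1 u`. -/
def tailCone (u : List (Fin 2)) : Set (Stream' (Fin 2)) := {x | x.tail ∈ cone u}

theorem mem_tailCone {u : List (Fin 2)} {x : Stream' (Fin 2)} :
    x ∈ tailCone u ↔ ∃ a, x ∈ cone (a :: u) := by
  constructor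
  · rintro ⟨t, ht⟩
    exact ⟨x.head, t, by rw [cons_append_stream, ← ht]; exact (Stream'.eta x).symm⟩
  · rintro ⟨a, t, rfl⟩
    exact ⟨t, rfl⟩

theorem _root_.Incomparable.disjoint_tailCone {u v : List (Fin 2)} (h : Incomparable u v) :
    Disjoint (tailCone u) (tailCone v) :=
  Set.disjoint_left.2 fun _ h1 h2 => Set.disjoint_left.1 h.disjoint h1 h2

theorem tailCone_anti {u v : List (Fin 2)} (h : u <+: v) : tailCone v ⊆ tailCone u :=
  fun _ hx => cone_anti h hx

theorem smul_flip_tail (hτ : IsConeSwap τ [0] [1]) (x : Stream' (Fin 2)) :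
    (τ • x).tail = x.tail := by
  rcases stream_cases x with ⟨t, rfl⟩ | ⟨t, rfl⟩
  · rw [hτ.left]; rfl
  · rw [hτ.right]; rfl

theorem eq_or_eq_flip_smul (hτ : IsConeSwap τ [0] [1]) {x y : Stream' (Fin 2)}
    (h : x.tail = y.tail) : y = x ∨ y = τ • x := by
  rcases stream_cases x with ⟨s, rfl⟩ | ⟨s, rfl⟩ <;>
    rcases stream_cases y with ⟨t, rfl⟩ | ⟨t, rfl⟩ <;>
    obtain rfl : s = t := h
  · exact Or.inl rfl
  · exact Or.inr (hτ.left s).symm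
  · exact Or.inr (hτ.right s).symm
  · exact Or.inl rfl

theorem flip_mul_self (hτ : IsConeSwap τ [0] [1]) : τ * τ = 1 :=
  eq_one_of_mapsCone_nil (d := []) (.of_children (hτ.right.mul hτ.left) (hτ.left.mul hτ.right))

/-- The elements of the centralizer of `τ` that fix all tails of infinite words have order at most
two. All other elements move a small set `tailCone u` off itself. -/
theorem exists_tailCone_displaced (hτ : IsConeSwap τ [0] [1]) {g : ThompsonHigman 2}
    (hg : Commute g τ) (hg2 : g * g ≠ 1) :
    ∃ u v, Incomparable u v ∧ ∀ x ∈ tailCone u, g • x ∈ tailCone v := by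
  have hcomm : ∀ x : Stream' (Fin 2), g • τ • x = τ • g • x := fun x => by
    rw [← mul_smul, hg.eq, mul_smul]
  obtain ⟨x, hx⟩ : ∃ x : Stream' (Fin 2), x.tail ≠ (g • x).tail := by
    by_contra! h
    refine hg2 (ext_smul_two fun x => ?_)
    rw [one_smul, mul_smul]
    rcases eq_or_eq_flip_smul hτ (h x) with e | e
    · rw [e, e]
    · rw [e, hcomm, e, ← mul_smul, flip_mul_self hτ, one_smul]
  obtain ⟨n, hn⟩ := exists_take_ne hx
  obtain ⟨N, hN⟩ := exists_mapsCone g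
  obtain ⟨v, hv⟩ := hN (x.take (N + 1)) (by simp)
  have hm := hv.append ((x.drop (N + 1)).take (n + 1))
  have hxu : x ∈ cone (x.take (N + 1) ++ (x.drop (N + 1)).take (n + 1)) := by
    rw [← take_add]
    exact mem_cone_take x _
  have hgx := hm.smul_mem hxu
  have hl1 : n + 1 ≤ (x.take (N + 1) ++ (x.drop (N + 1)).take (n + 1)).length := by simp
  have hl2 : n + 1 ≤ (v ++ (x.drop (N + 1)).take (n + 1)).length := by simp
  generalize x.take (N + 1) ++ (x.drop (N + 1)).take (n + 1) = u at hm hxu hl1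
  generalize v ++ (x.drop (N + 1)).take (n + 1) = w at hm hgx hl2
  obtain _ | ⟨a, u⟩ := u
  · simp at hl1
  obtain _ | ⟨b, w⟩ := w
  · simp at hl2
  simp only [List.length_cons, Nat.add_le_add_iff_right] at hl1 hl2
  -- now `g` maps the cone of `a u` to that of `b w`, where `u` and `w` have different prefixes of
  -- length `n`
  refine ⟨u, w, .of_disjoint (Set.disjoint_left.2 fun y h1 h2 => hn ?_), ?_⟩
  · exact (take_eq_take_of_mem_cone hl1 (mem_tailCone.2 ⟨a, hxu⟩) h1).trans
      (take_eq_take_of_mem_cone hl2 h2 (mem_tailCone.2 ⟨b, hgx⟩))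
  · -- the other cone in `tailCone u` is the image under `τ` of the cone of `a u`
    rintro y ⟨t, ht⟩
    have hcone : (g • ([a] ++ₛ (u ++ₛ t))).tail = w ++ₛ t := congrArg Stream'.tail (hm t)
    have hy : ([a] ++ₛ (u ++ₛ t)).tail = y.tail := ht.symm
    refine ⟨t, ?_⟩
    rcases eq_or_eq_flip_smul hτ hy with rfl | rfl
    · exact hcone
    · rw [hcomm, smul_flip_tail hτ, hcone]

/-- `s` acts on tails by interchanging the cones of `u` and `v`, and fixes first letters. -/
structure IsTailSwap (s : ThompsonHigman 2) (u v : List (Fin 2)) : Prop where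
  left : ∀ a : Fin 2, MapsCone s (a :: u) (a :: v)
  right : ∀ a : Fin 2, MapsCone s (a :: v) (a :: u)
  fix : ∀ x, x ∉ tailCone u → x ∉ tailCone v → s • x = x

theorem _root_.Incomparable.cons {u v : List (Fin 2)} (h : Incomparable u v) (a b : Fin 2) :
    Incomparable (a :: u) (b :: v) := by
  refine .of_disjoint (Set.disjoint_left.2 fun x h1 h2 => ?_)
  exact Set.disjoint_left.1 h.disjoint (mem_tailCone.2 ⟨a, h1⟩) (mem_tailCone.2 ⟨b, h2⟩)

theorem exists_isTailSwap {u v : List (Fin 2)} (h : Incomparable u v) :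
    ∃ s, IsTailSwap s u v := by
  obtain ⟨s₀, h₀⟩ := exists_isConeSwap (h.cons 0 0)
  obtain ⟨s₁, h₁⟩ := exists_isConeSwap (h.cons 1 1)
  have i : ∀ (a b : Fin 2) (u v : List (Fin 2)), a ≠ b → Incomparable (a :: u) (b :: v) :=
    fun a b u v hab => Incomparable.append (u := [a]) (v := [b])
      (.of_length_eq rfl fun h => hab (List.singleton_injective h)) u v
  have i01 := fun u v => i 0 1 u v (by decide)
  have i10 := fun u v => i 1 0 u v (by decide)
  refine ⟨s₀ * s₁, fun a => ?_, fun a => ?_, fun x hu hv => ?_⟩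
  · fin_cases a
    · exact h₀.left.mul (h₁.mapsCone_self (i01 _ _) (i01 _ _))
    · exact (h₀.mapsCone_self (i10 _ _) (i10 _ _)).mul h₁.left
  · fin_cases a
    · exact h₀.right.mul (h₁.mapsCone_self (i01 _ _) (i01 _ _))
    · exact (h₀.mapsCone_self (i10 _ _) (i10 _ _)).mul h₁.right
  · rw [mem_tailCone, not_exists] at hu hv
    rw [mul_smul, h₁.fix x (hu 1) (hv 1), h₀.fix x (hu 0) (hv 0)]

namespace IsTailSwap

variable {s : ThompsonHigman 2} {u v w : List (Fin 2)}

theorem smul_mem_left (hs : IsTailSwap s u v) {x : Stream' (Fin 2)} (hx : x ∈ tailCone u) :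
    s • x ∈ tailCone v := by
  obtain ⟨a, hx⟩ := mem_tailCone.1 hx
  exact mem_tailCone.2 ⟨a, (hs.left a).smul_mem hx⟩

theorem inv (hs : IsTailSwap s u v) : IsTailSwap s⁻¹ v u :=
  ⟨fun a => (hs.left a).inv, fun a => (hs.right a).inv,
    fun x hv hu => inv_smul_eq_iff.2 (hs.fix x hu hv).symm⟩

theorem fixesOutside (hs : IsTailSwap s u v) (hu : w <+: u) (hv : w <+: v) :
    FixesOutside s (tailCone w) :=
  fun x hx => hs.fix x (fun h => hx (tailCone_anti hu h)) fun h => hx (tailCone_anti hv h)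

theorem commute_flip (hτ : IsConeSwap τ [0] [1]) (hs : IsTailSwap s u v) : Commute s τ := by
  refine ext_smul_two fun x => ?_
  rw [mul_smul, mul_smul]
  have hcone : ∀ {u : List (Fin 2)}, τ • x ∈ tailCone u ↔ x ∈ tailCone u := fun {u} => by
    change (τ • x).tail ∈ cone u ↔ x.tail ∈ cone u
    rw [smul_flip_tail hτ]
  have hflip : ∀ a : Fin 2, ∃ b, ∀ t : Stream' (Fin 2), τ • ([a] ++ₛ t) = [b] ++ₛ t := by
    intro a
    fin_cases a
    · exact ⟨1, hτ.left⟩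
    · exact ⟨0, hτ.right⟩
  have key : ∀ {p q : List (Fin 2)}, (∀ a : Fin 2, MapsCone s (a :: p) (a :: q)) →
      x ∈ tailCone p → s • τ • x = τ • s • x := by
    intro p q hpq hx
    obtain ⟨a, t, rfl⟩ := mem_tailCone.1 hx
    obtain ⟨b, hb⟩ := hflip a
    have e1 : τ • ((a :: p) ++ₛ t) = (b :: p) ++ₛ t := hb (p ++ₛ t)
    have e2 : τ • ((a :: q) ++ₛ t) = (b :: q) ++ₛ t := hb (q ++ₛ t)
    rw [e1, hpq, hpq, e2]
  by_cases h1 : x ∈ tailCone u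
  · exact key hs.left h1
  by_cases h2 : x ∈ tailCone v
  · exact key hs.right h2
  rw [hs.fix x h1 h2, hs.fix _ (fun h => h1 (hcone.1 h)) fun h => h2 (hcone.1 h)]

end IsTailSwap

theorem exists_incomparable_append (u v : List (Fin 2)) :
    ∃ a b : Fin 2, Incomparable (u ++ [a]) (v ++ [b]) := by
  by_cases h1 : u <+: v
  · obtain ⟨r, rfl⟩ := h1
    obtain _ | ⟨c, r⟩ := r
    · exact ⟨0, 1, by simpa using Incomparable.concat (by decide) u⟩
    · obtain ⟨a, ha⟩ := exists_ne c
      refine ⟨a, 0, ?_⟩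
      simpa using (Incomparable.concat ha u).append [] (r ++ [0])
  by_cases h2 : v <+: u
  · obtain ⟨r, rfl⟩ := h2
    obtain _ | ⟨c, r⟩ := r
    · exact ⟨0, 1, by simpa using Incomparable.concat (by decide) v⟩
    · obtain ⟨a, ha⟩ := exists_ne c
      refine ⟨0, a, ?_⟩
      simpa using (Incomparable.concat ha.symm v).append (r ++ [0]) []
  · exact ⟨0, 0, Incomparable.append ⟨h1, h2⟩ _ _⟩

/-- The centralizer of `τ` acts on tails like `G_{2,1}`, and so it does not have two commuting
normal subgroups that act nontrivially on tails. -/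
theorem exists_not_commute_conj (hτ : IsConeSwap τ [0] [1]) {y z : ThompsonHigman 2}
    (hy : Commute y τ) (hz : Commute z τ) (hy2 : y * y ≠ 1) (hz2 : z * z ≠ 1) :
    ∃ c, Commute c τ ∧ ¬ Commute (c * y * c⁻¹) z := by
  by_contra! h
  obtain ⟨u, v, huv, hyu⟩ := exists_tailCone_displaced hτ hy hy2
  obtain ⟨p, q, hpq, hzp⟩ := exists_tailCone_displaced hτ hz hz2
  -- shrinking `u` and `p` makes them incomparable, so that some `c` interchanges them
  obtain ⟨a, b, hup⟩ := exists_incomparable_append u p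
  obtain ⟨c, hc⟩ := exists_isTailSwap hup
  have hcτ := hc.commute_flip hτ
  -- the conjugate `c y c⁻¹` moves `tailCone (p b)` off itself
  have hy' : ∀ x ∈ tailCone (p ++ [b]), (c * y * c⁻¹) • x ∉ tailCone (p ++ [b]) := by
    intro x hx hx'
    rw [mul_smul, mul_smul] at hx'
    have h1 := hyu _ (tailCone_anti (List.prefix_append u [a]) (hc.inv.smul_mem_left hx))
    have h2 := hc.inv.smul_mem_left hx'
    rw [inv_smul_smul] at h2
    exact Set.disjoint_left.1 huv.disjoint_tailCone
      (tailCone_anti (List.prefix_append u [a]) h2) h1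
  have i1 : Incomparable (p ++ [b] ++ [0] ++ [0]) (p ++ [b] ++ [0] ++ [1]) :=
    .concat (by decide) _
  have i2 : Incomparable (p ++ [b] ++ [0] ++ [1]) (p ++ [b] ++ [1]) := by
    simpa using (Incomparable.concat (show (0 : Fin 2) ≠ 1 by decide) (p ++ [b])).append [1] []
  have i3 : Incomparable (p ++ [b] ++ [1]) (p ++ [b] ++ [0] ++ [0]) := by
    simpa using (Incomparable.concat (show (1 : Fin 2) ≠ 0 by decide) (p ++ [b])).append [] [0]
  obtain ⟨s, hs⟩ := exists_isTailSwap i1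
  obtain ⟨t, ht⟩ := exists_isTailSwap i2
  have hsτ := hs.commute_flip hτ
  have htτ := ht.commute_flip hτ
  have hsf : FixesOutside s (tailCone (p ++ [b])) := hs.fixesOutside (by simp) (by simp)
  have htf : FixesOutside t (tailCone (p ++ [b])) := ht.fixesOutside (by simp) (by simp)
  have e := hsf.commutator_commutator htf hy'
  have hcomm : Commute ⁅s, t⁆ z := by
    have e' : ⁅⁅s, c * y * c⁻¹⁆, t⁆ = (s * c) * y * (s * c)⁻¹ * (c * y * c⁻¹)⁻¹ *
        ((t * c) * y * (t * c)⁻¹) * ((t * s * c) * y * (t * s * c)⁻¹)⁻¹ := by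
      simp only [commutatorElement_def]
      group
    rw [← e, e']
    exact (((h _ (hsτ.mul_left hcτ)).mul_left (h _ hcτ).inv_left).mul_left
      (h _ (htτ.mul_left hcτ))).mul_left (h _ ((htτ.mul_left hsτ).mul_left hcτ)).inv_left
  -- `z` commutes with `⁅s, t⁆` but moves its support off itself
  have hone : ⁅s, t⁆ = 1 := by
    have hf := hsf.commutator htf
    have hf' := hf.conj z
    rw [← hcomm.eq, mul_inv_cancel_right] at hf'
    refine hf.eq_one hf' (Set.disjoint_left.2 fun x h1 h2 => ?_)
    have h3 := hzp _ (tailCone_anti (List.prefix_append p [b]) h2)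
    rw [smul_inv_smul] at h3
    exact Set.disjoint_left.1 hpq.disjoint_tailCone
      (tailCone_anti (List.prefix_append p [b]) h1) h3
  -- `s t` and `t s` differ on the cone of `0 p b 1`
  have hst : s * t = t * s := commutatorElement_eq_one_iff_mul_comm.1 hone
  have m1 : MapsCone (s * t) (0 :: (p ++ [b] ++ [1])) (0 :: (p ++ [b] ++ [0] ++ [0])) :=
    (hs.right 0).mul (ht.right 0)
  have m2 : MapsCone (t * s) (0 :: (p ++ [b] ++ [1])) (0 :: (p ++ [b] ++ [0] ++ [1])) := by
    refine (ht.right 0).mul fun x => hs.fix _ ?_ ?_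
    · exact Set.disjoint_left.1 i3.disjoint_tailCone (mem_tailCone.2 ⟨0, append_mem_cone _ _⟩)
    · exact Set.disjoint_left.1 i2.symm.disjoint_tailCone
        (mem_tailCone.2 ⟨0, append_mem_cone _ _⟩)
  have := (hst ▸ m1).unique m2
  simp at this

end Flip

/-- In the centralizer of `π₀`, the elements supported on the cone of `11` form a normal subgroup
that commutes with all elements supported outside this cone. -/
theorem exists_commute_conj_cfpP : ∃ y z : ThompsonHigman 2, Commute y cfpP ∧ Commute z cfpP ∧
    y * y ≠ 1 ∧ z * z ≠ 1 ∧ ∀ c, Commute c cfpP → Commute (c * y * c⁻¹) z := by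
  have hB2 : cfpB * cfpB ≠ 1 := fun h => by
    have h1 : MapsCone (cfpB * cfpB) [1, 0] [1, 0, 0, 0] := (cfpB_10.append [0]).mul cfpB_10
    have := (h ▸ h1).unique (MapsCone.one _)
    simp at this
  have hsq : ∀ {g h : ThompsonHigman 2}, g * g ≠ 1 → (h * g * h⁻¹) * (h * g * h⁻¹) ≠ 1 := by
    intro g h hg e
    refine hg ?_
    have : h * (g * g) * h⁻¹ = 1 := by rw [← e]; group
    exact conj_eq_one_iff.1 this
  have hBf : FixesOutside cfpB (cone [1]) := by
    intro x hx
    rcases stream_cases x with ⟨t, rfl⟩ | ⟨t, rfl⟩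
    · exact cfpB_0 t
    · exact absurd (append_mem_cone _ _) hx
  have hconj : ∀ {g h : ThompsonHigman 2} {u v : List (Fin 2)}, FixesOutside g (cone u) →
      MapsCone h u v → FixesOutside (h * g * h⁻¹) (cone v) := fun hg hh =>
    (hg.conj _).mono fun x hx => by simpa using hh.smul_mem hx
  -- `B₀` is carried to the cones of `11`, `0` and `10`, and `z` acts by the same element on the
  -- last two, which are interchanged by `π₀`
  obtain ⟨h, -, hh⟩ := exists_mapsCone_zero 1 []
  have hyf := hconj hBf cfpA_11.inv
  have haf := hconj hBf hh
  have hbf := hconj haf cfpP_0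
  have i1 : Incomparable [(0 : Fin 2)] [1, 0] := ⟨by decide, by decide⟩
  have i2 : Incomparable [(0 : Fin 2)] [1, 1] := ⟨by decide, by decide⟩
  have i3 : Incomparable [(1 : Fin 2), 0] [1, 1] := ⟨by decide, by decide⟩
  have ha2 := hsq (h := h) hB2
  have hy2 := hsq (h := cfpA⁻¹) hB2
  generalize cfpA⁻¹ * cfpB * cfpA⁻¹⁻¹ = y at hyf hy2
  generalize h * cfpB * h⁻¹ = a at haf hbf ha2
  have hab := haf.commute hbf i1.disjoint
  have hPP : cfpP⁻¹ = cfpP := (eq_inv_of_mul_eq_one_left cfpP_mul_self).symm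
  have hPf : FixesOutside cfpP (cone [1, 1])ᶜ := by
    intro x hx
    rw [Set.notMem_compl_iff] at hx
    obtain ⟨t, rfl⟩ := hx
    exact cfpP_11 t
  have hzf : FixesOutside (a * (cfpP * a * cfpP⁻¹)) (cone [1, 1])ᶜ :=
    (haf.mono i2.disjoint.subset_compl_right).mul (hbf.mono i3.disjoint.subset_compl_right)
  refine ⟨y, a * (cfpP * a * cfpP⁻¹), hyf.commute hPf disjoint_compl_right, ?_, hy2, ?_, ?_⟩
  · have e : cfpP * (a * (cfpP * a * cfpP⁻¹)) = (cfpP * a * cfpP⁻¹) * a * cfpP := by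
      rw [hPP]
      simp only [mul_assoc]
    exact ((congrArg (· * cfpP) hab.eq).trans e.symm)
  · intro e
    refine ha2 ?_
    have e' : a * a = ((cfpP * a * cfpP⁻¹) * (cfpP * a * cfpP⁻¹))⁻¹ := by
      have := hab.mul_pow 2
      rw [sq, sq, sq, e] at this
      exact eq_inv_of_mul_eq_one_left this.symm
    refine (haf.mul haf).eq_one (T := cone [1, 0]) ?_ i1.disjoint
    rw [e']
    exact (hbf.mul hbf).inv
  · intro c hc
    refine (hyf.conj c).commute hzf (Set.disjoint_right.2 fun x h1 h2 => h1 ?_)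
    -- `c⁻¹` preserves the set of fixed points of `π₀`, which is the cone of `11`
    have hfix : cfpP • x = x := by
      obtain ⟨t, ht⟩ : c⁻¹ • x ∈ cone [1, 1] := h2
      have h3 : cfpP • c⁻¹ • x = c⁻¹ • x := by rw [ht]; exact cfpP_11 t
      rwa [← mul_smul, ← hc.inv_left.eq, mul_smul, smul_left_cancel_iff] at h3
    by_contra hx
    have hmem : x ∈ cone [0] ∨ x ∈ cone [1, 0] := by
      rcases stream_cases x with ⟨t, rfl⟩ | ⟨t, rfl⟩
      · exact Or.inl (append_mem_cone _ _)
      · exact (mem_cone_iff_child.1 (append_mem_cone [1] t)).imp_right (absurd · hx) |>.elim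
          Or.inr id
    rcases hmem with hx | hx
    · exact Set.disjoint_left.1 i1.disjoint hx (hfix ▸ cfpP_0.smul_mem hx)
    · exact Set.disjoint_left.1 i1.disjoint (hfix ▸ cfpP_10.smul_mem hx) hx

end ThompsonHigman

/-! ### Homomorphisms from suffix expansions to groups -/

namespace SuffixPair

variable {G : Type*} [Group G] {Γ : Set G}

theorem exists_elt_eq (hΓ : Submonoid.closure Γ = ⊤) (g : G) :
    ∃ p : suffixExpansion Γ, p.1.elt = g := by
  have hg : g ∈ Submonoid.closure Γ := hΓ ▸ Submonoid.mem_top g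
  induction hg using Submonoid.closure_induction with
  | mem γ hγ => exact ⟨⟨gen γ, Submonoid.subset_closure ⟨γ, hγ, rfl⟩⟩, rfl⟩
  | one => exact ⟨1, rfl⟩
  | mul g h _ _ ihg ihh =>
    obtain ⟨p, rfl⟩ := ihg
    obtain ⟨q, rfl⟩ := ihh
    exact ⟨p * q, rfl⟩

/-- Two elements `(g, S)` and `(g, T)` of a suffix expansion agree after right multiplication by
some `(1, U)` with `S ∪ T ⊆ U`. -/
theorem exists_mul_eq_mul (hΓ : Submonoid.closure Γ = ⊤) {p q : suffixExpansion Γ}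
    (h : p.1.elt = q.1.elt) : ∃ r : suffixExpansion Γ, p * r = q * r := by
  have key : ∀ p : suffixExpansion Γ, ∃ r : suffixExpansion Γ, r.1.elt = 1 ∧
      p.1.set ⊆ r.1.set := by
    intro p
    obtain ⟨p', hp'⟩ := exists_elt_eq hΓ p.1.elt⁻¹
    refine ⟨p' * p, ?_, Set.subset_union_right⟩
    change p'.1.elt * p.1.elt = 1
    rw [hp', inv_mul_cancel]
  obtain ⟨r, hr, hpr⟩ := key p
  obtain ⟨s, hs, hqs⟩ := key q
  have hset : (r * s).1.set = r.1.set ∪ s.1.set := by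
    change (fun t => t * s.1.elt) '' r.1.set ∪ s.1.set = _
    simp [hs]
  have helt : (r * s).1.elt = 1 := by
    change r.1.elt * s.1.elt = 1
    rw [hr, hs, one_mul]
  have hmul : ∀ p : suffixExpansion Γ, p.1.set ⊆ (r * s).1.set →
      (p * (r * s)).1.set = (r * s).1.set := by
    intro p hp
    change (fun t => t * (r * s).1.elt) '' p.1.set ∪ (r * s).1.set = _
    rw [helt]
    simp only [mul_one, Set.image_id']
    exact Set.union_eq_right.2 hp
  refine ⟨r * s, Subtype.ext (SuffixPair.ext ?_ ?_)⟩
  · change p.1.elt * (r * s).1.elt = q.1.elt * (r * s).1.elt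
    rw [h]
  · rw [hmul p (hset ▸ hpr.trans Set.subset_union_left),
      hmul q (hset ▸ hqs.trans Set.subset_union_right)]

/-- The maximal group image of a suffix expansion of a group `G` is `G`: homomorphisms to groups
factor through `(g, S) ↦ g`. -/
theorem exists_factorization (hΓ : Submonoid.closure Γ = ⊤) {H : Type*} [Group H]
    (f : suffixExpansion Γ →* H) : ∃ α : G →* H, ∀ p, f p = α p.1.elt := by
  have hf : ∀ {p q : suffixExpansion Γ}, p.1.elt = q.1.elt → f p = f q := by
    intro p q h
    obtain ⟨r, hr⟩ := exists_mul_eq_mul hΓ h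
    have := congrArg f hr
    rwa [map_mul, map_mul, mul_left_inj] at this
  choose σ hσ using exists_elt_eq hΓ
  refine ⟨MonoidHom.mk' (fun g => f (σ g)) fun g h => ?_, fun p => hf (hσ _).symm⟩
  rw [← map_mul]
  refine hf ?_
  change _ = (σ g).1.elt * (σ h).1.elt
  rw [hσ, hσ, hσ]

end SuffixPair

namespace ThompsonHigman

/-! ### Homomorphisms onto `riAut(2)` -/

/-- The elements of `G_{2,1}` that are defined at both letters: the images of the two cones
partition the infinite words, so they are the cones of the two letters. -/
theorem eq_one_or_isConeSwap {g : ThompsonHigman 2} {u v : List (Fin 2)} (hu : MapsCone g [0] u)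
    (hv : MapsCone g [1] v) : g = 1 ∨ IsConeSwap g [0] [1] := by
  have huv : Incomparable u v := hu.incomparable hv ⟨by decide, by decide⟩
  have hcover : ∀ x : Stream' (Fin 2), x ∈ cone u ∨ x ∈ cone v := by
    intro x
    rcases stream_cases (g⁻¹ • x) with ⟨t, ht⟩ | ⟨t, ht⟩
    · exact Or.inl ⟨t, by rw [← hu, ← ht, smul_inv_smul]⟩
    · exact Or.inr ⟨t, by rw [← hv, ← ht, smul_inv_smul]⟩
  obtain _ | ⟨a, u⟩ := u
  · exact absurd List.nil_prefix huv.1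
  obtain _ | ⟨b, v⟩ := v
  · exact absurd List.nil_prefix huv.2
  have head_eq : ∀ {c d : Fin 2} {w : List (Fin 2)} {x : Stream' (Fin 2)},
      [c] ++ₛ x ∈ cone (d :: w) → c = d := fun ⟨_, ht⟩ => congrArg head ht
  have hab : a ≠ b := by
    rintro rfl
    obtain ⟨c, hc⟩ := exists_ne a
    rcases hcover ([c] ++ₛ const 0) with h | h <;> exact hc (head_eq h)
  -- a word in the cone of the second letter that branches off `u` or `v` would be missed
  have hnil : ∀ {a b : Fin 2} {u v : List (Fin 2)}, a ≠ b →
      (∀ x : Stream' (Fin 2), x ∈ cone (a :: u) ∨ x ∈ cone (b :: v)) → u = [] := by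
    intro a b u v hab h
    obtain _ | ⟨c, u⟩ := u
    · rfl
    · obtain ⟨d, hd⟩ := exists_ne c
      rcases h ([a] ++ₛ ([d] ++ₛ const 0)) with h | h
      · obtain ⟨t, ht⟩ := h
        exact absurd (head_eq (x := const 0) (w := u) ⟨t, congrArg Stream'.tail ht⟩) hd
      · exact absurd (head_eq h) hab
  obtain rfl := hnil hab hcover
  obtain rfl := hnil hab.symm fun x => (hcover x).symm
  have hfin : ∀ a b : Fin 2, a ≠ b → a = 0 ∧ b = 1 ∨ a = 1 ∧ b = 0 := by decide
  rcases hfin a b hab with ⟨rfl, rfl⟩ | ⟨rfl, rfl⟩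
  · exact Or.inl (eq_one_of_mapsCone_nil (d := []) (.of_children hu hv))
  · refine Or.inr ⟨hu, hv, fun x h0 h1 => ?_⟩
    rcases stream_cases x with ⟨t, rfl⟩ | ⟨t, rfl⟩
    · exact absurd (append_mem_cone _ _) h0
    · exact absurd (append_mem_cone _ _) h1

/-- A set of generators of `riAut(2)` contains an element whose maximal extension is the
interchange of the cones of `0` and `1`: composites of elements that are not defined at both
letters are not defined at both letters. -/
theorem exists_isConeSwap_of_surjective {Γ : Set (ThompsonHigman 2)}
    {θ : suffixExpansion Γ →* RiAut 2} (hθ : Function.Surjective θ) :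
    ∃ γ, ∃ hγ : γ ∈ Γ, IsConeSwap
      (eta 2 (θ ⟨SuffixPair.gen γ, Submonoid.subset_closure ⟨γ, hγ, rfl⟩⟩)) [0] [1] := by
  by_contra! h
  have hmem : ∀ {φ : RiAut 2} {x y : List (Fin 2)}, y ∈ φ.toPEquiv x → MapsCone (eta 2 φ) x y :=
    fun hy => mapsCone_of_mem (RiAut.isExtendedBy_maxExt _ _ _ hy)
  have key : ∀ (p : SuffixPair (ThompsonHigman 2)) (hp : p ∈ suffixExpansion Γ),
      (∀ a : Fin 2, [a] ∈ (θ ⟨p, hp⟩).Dom) → eta 2 (θ ⟨p, hp⟩) = 1 := by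
    intro p hp
    induction hp using Submonoid.closure_induction with
    | mem p hp =>
      obtain ⟨γ, hγ, rfl⟩ := hp
      intro hd
      obtain ⟨u, hu⟩ := hd 0
      obtain ⟨v, hv⟩ := hd 1
      exact (eq_one_or_isConeSwap (hmem hu) (hmem hv)).resolve_right (h γ hγ)
    | one =>
      intro _
      change eta 2 (θ 1) = 1
      rw [map_one, map_one]
    | mul p q hp hq ihp ihq =>
      intro hd
      have hpq : θ ⟨p * q, mul_mem hp hq⟩ = θ ⟨p, hp⟩ * θ ⟨q, hq⟩ :=
        map_mul θ ⟨p, hp⟩ ⟨q, hq⟩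
      rw [hpq] at hd ⊢
      have hd' : ∀ a : Fin 2, ∃ y, y ∈ (θ ⟨q, hq⟩).toPEquiv [a] ∧ y ∈ (θ ⟨p, hp⟩).Dom := by
        intro a
        obtain ⟨z, hz⟩ := hd a
        obtain ⟨y, hy, hz⟩ := RiAut.mem_mul.1 hz
        exact ⟨y, hy, z, hz⟩
      have hq1 := ihq fun a => (hd' a).imp fun _ => And.left
      have hp1 := ihp fun a => by
        obtain ⟨y, hy, hyp⟩ := hd' a
        have := hmem hy
        rw [hq1] at this
        rwa [this.unique (.one _)] at hyp
      rw [map_mul, hp1, hq1, one_mul]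
  have hN : ∃ N : ℕ, ∀ x : List (Fin 2), N ≤ x.length → x ∈ {x : List (Fin 2) | 1 ≤ x.length} :=
    ⟨1, fun _ hx => hx⟩
  obtain ⟨⟨p, hp⟩, hpθ⟩ := hθ (RiAut.caretSwap _ (RiAut.isRightIdeal_length 1) hN 0 1)
  have hone := key p hp fun a => by
    rw [hpθ, RiAut.dom_caretSwap]
    simp
  have hcaret : RiAut.IsCaret {x : List (Fin 2) | 1 ≤ x.length} [] := by
    constructor <;> simp
  have hswap := hmem (RiAut.caretSwap_mem_of_isCaret (hR := RiAut.isRightIdeal_length 1)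
    (hN := hN) (a := 0) (b := 1) hcaret)
  rw [← hpθ, hone] at hswap
  have := hswap.unique (.one _)
  simp at this

/-- A surjection onto `riAut(2)` induces an automorphism `α` of the simple group `G_{2,1}` with
`α(π₀) = τ`, the interchange of the cones of `0` and `1`; but the centralizers of `π₀` and `τ` are
not isomorphic. -/
theorem not_surjective_suffixExpansion_cannonFloydParry :
    ¬ ∃ θ : suffixExpansion cannonFloydParry →* RiAut 2, Function.Surjective θ := by
  rintro ⟨θ, hθ⟩
  obtain ⟨α, hα⟩ := SuffixPair.exists_factorization closure_cannonFloydParry ((eta 2).comp θ)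
  have hsurj : Function.Surjective α := by
    intro g
    obtain ⟨φ, rfl⟩ := eta_surjective g
    obtain ⟨p, rfl⟩ := hθ φ
    exact ⟨p.1.elt, (hα p).symm⟩
  obtain ⟨γ, hγ, hτ⟩ := exists_isConeSwap_of_surjective hθ
  have hγτ : α γ = eta 2 (θ ⟨SuffixPair.gen γ, Submonoid.subset_closure ⟨γ, hγ, rfl⟩⟩) :=
    (hα ⟨SuffixPair.gen γ, Submonoid.subset_closure ⟨γ, hγ, rfl⟩⟩).symm
  rw [← hγτ] at hτ
  have hinj : Function.Injective α := by
    rw [← MonoidHom.ker_eq_bot_iff]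
    by_contra hne
    have hmem : γ ∈ α.ker := eq_top_of_normal hne ▸ Subgroup.mem_top γ
    have h1 := hτ.left
    rw [MonoidHom.mem_ker.1 hmem] at h1
    have := h1.unique (.one _)
    simp at this
  -- `π₀` is the only involution among the generators
  have hγ2 : γ * γ = 1 := hinj (by rw [map_mul, flip_mul_self hτ, map_one])
  have hne : ∀ {g : ThompsonHigman 2} {u v : List (Fin 2)}, MapsCone (g * g) u v → u ≠ v →
      γ ≠ g := by
    rintro g u v hm huv rfl
    rw [hγ2] at hm
    exact huv ((MapsCone.one u).unique hm)
  have hγP : γ = cfpP := by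
    rw [cannonFloydParry_eq] at hγ
    rcases hγ with h | h | h | h
    · exact absurd h (hne ((cfpA_0.append [0]).mul cfpA_0) (by decide))
    · exact absurd h (hne ((cfpB_10.append [0]).mul cfpB_10) (by decide))
    · exact absurd h (hne (cfpC_11.mul cfpC_0) (by decide))
    · exact h
  subst hγP
  obtain ⟨y, z, hy, hz, hy2, hz2, hyz⟩ := exists_commute_conj_cfpP
  obtain ⟨c, hc, hcyz⟩ := exists_not_commute_conj hτ (hy.map α) (hz.map α)
    (by rw [← map_mul]; exact fun h => hy2 (hinj (h.trans (map_one α).symm)))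
    (by rw [← map_mul]; exact fun h => hz2 (hinj (h.trans (map_one α).symm)))
  obtain ⟨c, rfl⟩ := hsurj c
  have hc' : Commute c cfpP := hinj (by rw [map_mul, map_mul, hc.eq])
  apply hcyz
  have := (hyz c hc').map α
  rwa [map_mul, map_mul, map_inv] at this

end ThompsonHigman

theorem proposition4p5 :
    (∀ k : ℕ, 2 ≤ k →
      -- (1) every generating set of `riAut(k)` yields a suitable generating set of `G_{k,1}`
      (∀ Δ : Set (RiAut k), Submonoid.closure Δ = ⊤ →
        ∃ Γ : Set (ThompsonHigman k), Submonoid.closure Γ = ⊤ ∧ DomainsMatch Δ Γ ∧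
          (Δ.Finite → Γ.Finite ∧ Γ.ncard ≤ 2 * Δ.ncard)) ∧
      -- (1) `Γ = G_{k,1}` works
      SurjectivenessCondition (Set.univ : Set (ThompsonHigman k)) ∧
      -- (2) the condition is necessary for `ρ` to be onto `e(riAut(k))`
      (∀ Γ : Set (ThompsonHigman k), Submonoid.closure Γ = ⊤ →
        Set.range (eMap (k := k)) ⊆ Set.range (rhoMap Γ) → SurjectivenessCondition Γ) ∧
      -- (3) the condition can fail
      (∃ Γ : Set (ThompsonHigman k), Submonoid.closure Γ = ⊤ ∧ ¬ SurjectivenessCondition Γ)) ∧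
    -- (3) the four-element set of Cannon, Floyd and Parry generates `G_{2,1}`, violates the
    -- condition, and its suffix expansion has no surjective homomorphism onto `riAut(2)`
    (cannonFloydParry.Finite ∧ cannonFloydParry.ncard = 4 ∧
      Submonoid.closure cannonFloydParry = ⊤ ∧
      ¬ SurjectivenessCondition cannonFloydParry ∧
      ¬ ∃ θ : suffixExpansion cannonFloydParry →* RiAut 2, Function.Surjective θ) := by
  refine ⟨fun k hk => ?_, ThompsonHigman.cannonFloydParry_ncard.1,
    ThompsonHigman.cannonFloydParry_ncard.2, ThompsonHigman.closure_cannonFloydParry,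
    ThompsonHigman.not_surjectivenessCondition_cannonFloydParry,
    ThompsonHigman.not_surjective_suffixExpansion_cannonFloydParry⟩
  have hab : (⟨0, by omega⟩ : Fin k) ≠ ⟨1, by omega⟩ := by simp
  exact ⟨fun Δ hΔ => ThompsonHigman.exists_generators_domainsMatch hab hΔ,
    ThompsonHigman.surjectivenessCondition_univ hab,
    fun Γ _ h => ThompsonHigman.surjectivenessCondition_of_range_subset h,
    ThompsonHigman.exists_generators_not_surjectivenessCondition hab⟩
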